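/- **Setting.** Let $q$ be a prime power and $n\ge 1$. Write points of $\mathrm{PG}(2,q^n)$ as $(a,b,c)_{\mathbb F_{q^n}}$ and let $l_\infty$ be the line $c=0$. Write points of $\mathrm{PG}(2n,q)$ as $(a,b,c)_{\mathbb F_q}$ with $a,b\in\mathbb F_{q^n}$, $c\in\mathbb F_q$, and let $H_\infty$ be the hyperplane $c=0$. The ABB-map $\phi$ sends $(a,b,1)_{\mathbb F_{q^n}}$ to the point $(a,b,1)_{\mathbb F_q}$ and $(a,b,0)_{\mathbb F_{q^n}}$ to the spread element $\{(ax,bx,0)_{\mathbb F_q}: x\in\mathbb F_{q^n}^*\}$; the ABB-representation of a point set is the union of the images of its points. For $k\mid n$, let $$\mathcal D_k=\bigl\{\{(ax,bx,0)_{\mathbb F_q}:x\in\mathbb F_{q^k}^*\}: a,b\in\mathbb F_{q^n},\ (a,b)\ne(0,0)\bigr\}.$$ Embed $\mathrm{PG}(2n,q)$ in $\mathrm{PG}(2n,q^n)$ by $\iota:(a,b,c)_{\mathbb F_q}\mapsto(a,a^q,\dots,a^{q^{n-1}};b,b^q,\dots,b^{q^{n-1}};c)_{\mathbb F_{q^n}}$,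 let $\sigma$ be the collineation $$(a_0,\dots,a_{n-1};b_0,\dots,b_{n-1};c)\mapsto(a_{n-1}^q,a_0^q,\dots,a_{n-2}^q;b_{n-1}^q,b_0^q,\dots,b_{n-2}^q;c^q),$$ and let $\nu$ be the line spanned by the two points whose only nonzero coordinate is $a_0$, respectively $b_0$. For $k\mid n$ put $\Pi=\langle\nu,\nu^{\sigma^k},\nu^{\sigma^{2k}},\dots,\nu^{\sigma^{n-k}}\rangle\cap\mathrm{Fix}(\sigma^k)$; the indicator set of $\mathcal D_k$ is $\{\Pi,\Pi^\sigma,\dots,\Pi^{\sigma^{k-1}}\}$. A normal rational curve of degree $k$ in $\mathrm{PG}(N,Q)$, where $2\le k\le Q$, is a set $\{(s^ke_0+s^{k-1}te_1+\dots+t^ke_k)_{\mathbb F_Q}: s,t\in\mathbb F_Q,\ (s,t)\ne(0,0)\}$ with $e_0,\dots,e_k$ linearly independent. An $\mathbb F_{q^n}$-extension of a normal rational curve $\mathcal C$ of degree $k$ in $\mathrm{PG}(2n,q)$ is a normal rational curve $\mathcal C^*$ of degree $k$ in $\mathrm{PG}(2n,q^n)$ containing $\iota(\mathcal C)$ (it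 is unique when $k+2\le q$). For vectors $u,v$ of $\mathbb F_{q^n}^3$ linearly independent over $\mathbb F_{q^n}$ and a subfield $L$ of $\mathbb F_{q^n}$, the set $\{(su+tv)_{\mathbb F_{q^n}}: s,t\in L,\ (s,t)\neq(0,0)\}$ is an $L$-subline. A subline is external to $l_\infty$ if it has no point on $l_\infty$, and tangent to $l_\infty$ if it has exactly one. **Theorem 2.6.** Assume $q\ge n$. A set $\mathcal C$ of points of $\mathrm{PG}(2n,q)$ is the ABB-representation of an $\mathbb F_q$-subline $m$ of $\mathrm{PG}(2,q^n)$ external to $l_\infty$ if and only if there is a divisor $k$ of $n$ such that (i) $\mathcal C$ is a normal rational curve of degree $k$ (so $k\ge2$) contained in a $k$-space that meets $H_\infty$ in an element of $\mathcal D_k$, and (ii) $\mathcal C$ has an $\mathbb F_{q^n}$-extension $\mathcal C^*$ whose intersection with $\Pi\cup\Pi^\sigma\cup\dots\cup\Pi^{\sigma^{k-1}}$ consists of $k$ distinct conjugate points $Q,Q^\sigma,\dots,Q^{\sigma^{k-1}}$. Moreover, if $m$ is an $\mathbb F_q$-subline external to $l_\infty$ and $k\mid n$ is such that (i) and (ii)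 hold for the ABB-representation of $m$, then among all sublines containing $m$ and tangent to $l_\infty$ there is a unique one with the smallest number of points, and it is an $\mathbb F_{q^k}$-subline. -/

import Mathlib

open scoped LinearAlgebra.Projectivization

noncomputable section

namespace ABB

/-! Throughout, `F` is the field with `q` elements and `K` its extension of degree `n`. -/

/-- `P = (v)_k`: the point `P` of `PG(V)` is defined by the vector `v`
(never true for `v = 0`). -/
def IsPt {k V : Type*} [Field k] [AddCommGroup V] [Module k V] (v : V) (P : ℙ k V) : Prop :=
  P.submodule = Submodule.span k {v}

section NormalRationalCurves

variable (k : Type*) {V : Type*} [Field k] [AddCommGroup V] [Module k V]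

/-- `C` is a normal rational curve of degree `d`, where `2 ≤ d ≤ |k|`:
`C = {(s ^ d e₀ + s ^ (d - 1) t e₁ + ⋯ + t ^ d e_d)_k}` with `e₀, …, e_d` linearly independent. -/
def IsNRC (d : ℕ) (C : Set (ℙ k V)) : Prop :=
  2 ≤ d ∧ d ≤ Nat.card k ∧ ∃ e : Fin (d + 1) → V, LinearIndependent k e ∧
    C = {P | ∃ s t : k, IsPt (∑ i : Fin (d + 1), (s ^ (d - (i : ℕ)) * t ^ (i : ℕ)) • e i) P}

/-- The point set of the projective subspace defined by a vector subspace. -/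
def pts (W : Submodule k V) : Set (ℙ k V) := {P | P.submodule ≤ W}

end NormalRationalCurves

section Plane

variable (K : Type*) [Field K]

/-- The points of the projective plane over `K`. -/
abbrev Plane := ℙ K (K × K × K)

/-- The line at infinity `c = 0` of the projective plane over `K`. -/
def lInf : Set (Plane K) := {P | ∃ a b : K, IsPt ((a, b, 0) : K × K × K) P}

/-- `m` is a subline of order `Q` of the projective plane over `K`: the points of a line having
coordinates in the subfield `L` with `Q` elements, for suitable coordinates on that line. -/
def IsSubline (Q : ℕ) (m : Set (Plane K)) : Prop :=
  ∃ L : Subfield K, Nat.card L = Q ∧ ∃ u v : K × K × K, LinearIndependent K ![u, v] ∧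
    m = {P | ∃ s ∈ L, ∃ t ∈ L, IsPt (s • u + t • v) P}

variable {K}

/-- `m` has no point on the line at infinity. -/
def External (m : Set (Plane K)) : Prop := m ∩ lInf K = ∅

/-- `m` has exactly one point on the line at infinity. -/
def Tangent (m : Set (Plane K)) : Prop := (m ∩ lInf K).ncard = 1

/-- `m'` is a subline (of some order) that contains `m` and is tangent to the line at infinity. -/
def IsTangentSublineOver (m m' : Set (Plane K)) : Prop :=
  (∃ Q, IsSubline K Q m') ∧ m ⊆ m' ∧ Tangent m'

/-- `m'` is the smallest subline (the one with the smallest number of points) that contains `m` and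
is tangent to the line at infinity. -/
def IsSmallestTangentSubline (m m' : Set (Plane K)) : Prop :=
  IsTangentSublineOver m m' ∧
    ∀ m'', IsTangentSublineOver m m'' → m'' ≠ m' → m'.ncard < m''.ncard

end Plane

section Representation

variable (F K : Type*) [Field F] [Fintype F] [Field K] [Algebra F K]

/-- The points of `Σ = PG(2n, q)`, written `(a, b, c)_F` with `a, b ∈ K` and `c ∈ F`. -/
abbrev Sig := ℙ F (K × K × F)

/-- The hyperplane at infinity `c = 0` of `Σ`. -/
def hInf : Set (Sig F K) := {R | ∃ a b : K, IsPt ((a, b, 0) : K × K × F) R}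

/-- The ABB-map: `(a, b, 1)_K` goes to the point `(a, b, 1)_F`, and `(a, b, 0)_K` goes to the spread
element `{(a x, b x, 0)_F | x ∈ K, x ≠ 0}`. -/
def abb (P : Plane K) : Set (Sig F K) :=
  {R | ∃ a b : K,
    (IsPt ((a, b, 1) : K × K × K) P ∧ IsPt ((a, b, 1) : K × K × F) R) ∨
    (IsPt ((a, b, 0) : K × K × K) P ∧
      ∃ x : K, x ≠ 0 ∧ IsPt ((a * x, b * x, 0) : K × K × F) R)}

/-- The ABB-representation of a set of points of the plane. -/
def abbImage (m : Set (Plane K)) : Set (Sig F K) := ⋃ P ∈ m, abb F K P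

/-- The subspread `𝒟_k`: its elements are `{(a x, b x, 0)_F | x ∈ 𝔽_{q^k}, x ≠ 0}` with
`(a, b) ≠ (0, 0)`. It is used for `k ∣ n`, when `𝔽_{q^k} = {x ∈ K | x ^ (q ^ k) = x}`. -/
def subspread (k : ℕ) : Set (Set (Sig F K)) :=
  {E | ∃ a b : K, (a, b) ≠ (0, 0) ∧
    E = {R | ∃ x : K, x ^ (Fintype.card F ^ k) = x ∧ x ≠ 0 ∧
      IsPt ((a * x, b * x, 0) : K × K × F) R}}

variable (n : ℕ)

/-- Coordinate vectors `(a₀, …, a_{n-1}; b₀, …, b_{n-1}; c)` of `Σ* = PG(2n, q^n)`. -/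
abbrev VStar := (Fin n → K) × (Fin n → K) × K

/-- The points of `Σ* = PG(2n, q^n)`. -/
abbrev SigStar := ℙ K (VStar K n)

variable {K}

theorem add_pow_q (i : ℕ) (x y : K) :
    (x + y) ^ (Fintype.card F ^ i) = x ^ (Fintype.card F ^ i) + y ^ (Fintype.card F ^ i) := by
  induction i with
  | zero => simp
  | succ i ih =>
    have h := map_add (FiniteField.frobeniusAlgHom F K)
    simp only [FiniteField.coe_frobeniusAlgHom] at h
    rw [pow_succ, pow_mul, pow_mul, pow_mul, ih, h]

theorem algebraMap_pow_q (i : ℕ) (c : F) :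
    (algebraMap F K c) ^ (Fintype.card F ^ i) = algebraMap F K c := by
  rw [← map_pow, FiniteField.pow_card_pow]

variable (K)

/-- The embedding `(a, b, c) ↦ (a, a^q, …, a^{q^{n-1}}; b, b^q, …, b^{q^{n-1}}; c)` on vectors. -/
def iotaVec : (K × K × F) →ₛₗ[algebraMap F K] VStar K n where
  toFun v := (fun i => v.1 ^ (Fintype.card F ^ (i : ℕ)),
    fun i => v.2.1 ^ (Fintype.card F ^ (i : ℕ)), algebraMap F K v.2.2)
  map_add' v w := by
    ext <;> simp [add_pow_q]
  map_smul' r v := by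
    ext <;> simp [Algebra.smul_def, mul_pow, algebraMap_pow_q]

variable [NeZero n]

theorem iotaVec_injective : Function.Injective (iotaVec F K n) := by
  intro v w h
  have h1 := congrFun (congrArg Prod.fst h) 0
  have h2 := congrFun (congrArg (fun z => z.2.1) h) 0
  have h3 := congrArg (fun z => z.2.2) h
  simp only [iotaVec, LinearMap.coe_mk, AddHom.coe_mk, Fin.coe_ofNat_eq_mod, Nat.zero_mod,
    pow_zero, pow_one] at h1 h2 h3
  exact Prod.ext h1 (Prod.ext h2 ((algebraMap F K).injective h3))

/-- The embedding `ι` of `Σ = PG(2n, q)` in `Σ* = PG(2n, q^n)` as a subgeometry. -/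
def iota : Sig F K → SigStar K n := Projectivization.map (iotaVec F K n) (iotaVec_injective F K n)

/-- The semilinear map `(a₀, …, a_{n-1}; b₀, …, b_{n-1}; c) ↦
(a_{n-1}^q, a₀^q, …, a_{n-2}^q; b_{n-1}^q, b₀^q, …, b_{n-2}^q; c^q)`; the indices are cyclic. -/
def sigmaVec : VStar K n →ₛₗ[(FiniteField.frobeniusAlgHom F K : K →+* K)] VStar K n where
  toFun v := (fun i => v.1 (i - 1) ^ Fintype.card F, fun i => v.2.1 (i - 1) ^ Fintype.card F,
    v.2.2 ^ Fintype.card F)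
  map_add' v w := by
    have h := add_pow_q F (K := K) 1
    simp only [pow_one] at h
    ext <;> simp [h]
  map_smul' r v := by
    ext <;> simp [mul_pow]

theorem sigmaVec_injective : Function.Injective (sigmaVec F K n) := by
  have hq : Function.Injective (fun x : K => x ^ Fintype.card F) := by
    rw [← FiniteField.coe_frobeniusAlgHom F K]
    exact (FiniteField.frobeniusAlgHom F K : K →+* K).injective
  intro v w h
  have h1 := fun i => congrFun (congrArg Prod.fst h) i
  have h2 := fun i => congrFun (congrArg (fun z => z.2.1) h) i
  have h3 := congrArg (fun z => z.2.2) h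
  refine Prod.ext (funext fun i => ?_) (Prod.ext (funext fun i => ?_) (hq h3))
  · have := h1 (i + 1)
    simp only [sigmaVec, LinearMap.coe_mk, AddHom.coe_mk, add_sub_cancel_right] at this
    exact hq this
  · have := h2 (i + 1)
    simp only [sigmaVec, LinearMap.coe_mk, AddHom.coe_mk, add_sub_cancel_right] at this
    exact hq this

/-- The collineation `σ` of `Σ*`; the points `Q, Q^σ, Q^{σ^2}, …` are called conjugate. -/
def sigma : SigStar K n → SigStar K n :=
  Projectivization.map (sigmaVec F K n) (sigmaVec_injective F K n)

/-- The line `ν` (as a subspace of vectors), spanned by `(1, 0, …, 0; 0, …, 0; 0)` and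
`(0, …, 0; 1, 0, …, 0; 0)`. -/
def nu : Submodule K (VStar K n) :=
  Submodule.span K {(Pi.single 0 1, 0, 0), (0, Pi.single 0 1, 0)}

/-- `Π = ⟨ν, ν^{σ^k}, …, ν^{σ^{n-k}}⟩ ∩ Fix(σ^k)`, for `k ∣ n`. -/
def indicatorSpace (k : ℕ) : Set (SigStar K n) :=
  pts K (Submodule.span K
    {w | ∃ r < n / k, ∃ v ∈ nu K n, w = (sigmaVec F K n)^[k * r] v}) ∩
    {R | (sigma F K n)^[k] R = R}

/-- All points lying on some element of the indicator set `{Π, Π^σ, …, Π^{σ^{k-1}}}` of `𝒟_k`. -/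
def indicatorPoints (k : ℕ) : Set (SigStar K n) :=
  ⋃ j ∈ Set.Iio k, (sigma F K n)^[j] '' indicatorSpace F K n k

/-- `Cs` is an `𝔽_{q^n}`-extension of the normal rational curve `C` of degree `k`: a normal
rational curve of degree `k` over `K` that contains the points of `C`. -/
def IsExtension (k : ℕ) (C : Set (Sig F K)) (Cs : Set (SigStar K n)) : Prop :=
  IsNRC K k Cs ∧ iota F K n '' C ⊆ Cs

/-- `C` is a normal rational curve of degree `k` contained in a `k`-space that meets the hyperplane
at infinity in an element of `𝒟_k`. -/
def CondI (k : ℕ) (C : Set (Sig F K)) : Prop :=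
  IsNRC F k C ∧ ∃ W : Submodule F (K × K × F), Module.finrank F W = k + 1 ∧ C ⊆ pts F W ∧
    pts F W ∩ hInf F K ∈ subspread F K k

/-- The extension of `C` meets the indicator set of `𝒟_k` in `k` (distinct) conjugate points
`Q, Q^σ, …, Q^{σ^{k-1}}`. -/
def CondII (k : ℕ) (C : Set (Sig F K)) : Prop :=
  ∃ Cs : Set (SigStar K n), IsExtension F K n k C Cs ∧
    ∃ Q : SigStar K n, Set.InjOn (fun j => (sigma F K n)^[j] Q) (Set.Iio k) ∧
      Cs ∩ indicatorPoints F K n k = (fun j => (sigma F K n)^[j] Q) '' Set.Iio k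

end Representation

end ABB

end

noncomputable section

set_option linter.unusedSectionVars false

namespace ABB

/-! ### Points of a projective space and their vectors -/

section Points

variable {k V : Type*} [Field k] [AddCommGroup V] [Module k V]

/-! Write `F` for the field with q elements. After a change of basis, an external `F`-subline
consists of the affine points v and v + (t - θ)⁻¹ w, with t in `F`, w ≠ 0 and θ not in `F`
(`exists_external_iff`). So the equivalence characterises the curves `affineCurve F v w θ`, and the
degree k turns out to be that of the minimal polynomial N of θ, which divides n.

From subline to curve: multiplying by N(t) clears the denominator. N(t)/(t - θ) is a polynomial in t
whose coefficients form an `F`-basis of F(θ), so (N(t) v + N(t)/(t - θ) w, N(t)) runs over a normal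
rational curve of degree k in the space {(c v + y w, c) : c ∈ F, y ∈ F(θ)}; q ≥ n guarantees k ≤ q.
Extending the parameter to `K`, the last coordinate N(t) vanishes exactly at the conjugates of θ. At
the j-th conjugate, the i-th Frobenius conjugate of N(X)/(X - θ) is nonzero only for i ≡ j mod k, so
the curve passes there through the j-th conjugate point of the indicator set (`nrcVec_conj`).

From curve to subline: let P = v be an affine point of the curve and write its other points as v + y
w, with w a vector of the spread element. On the extended curve, y^(q^i) is a quotient of two forms
of degree k: the denominator (last coordinate) vanishes at the k conjugate points, the numerator at
P and at all conjugate points except one. Cancelling the common zeros leaves a quotient of linear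
forms (`form_relation`). The cases i = 0 and i = 1 have the same numerator, which vanishes at P, so
Y = 1/y satisfies Y^q = A Y + B. The solutions of this equation differ by `F`-multiples of one
element, and since the curve has more than q points, all of them occur (`exists_eq_affineCurve`).

Smallest tangent subline: a subline containing m is spanned by the same two vectors over a larger
subfield M (`subline_eq_of_subset`), and it meets the line at infinity only if θ lies in M. The
smallest choice is M = F(θ), of order q^k; k is determined by the curve, because a normal rational
curve of degree k spans a k-space. -/

theorem isPt_mk {v : V} (hv : v ≠ 0) : IsPt v (Projectivization.mk k v hv) := by
  rw [IsPt, Projectivization.submodule_mk]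

theorem IsPt.ne_zero {v : V} {P : ℙ k V} (h : IsPt v P) : v ≠ 0 := by
  rintro rfl
  have h0 : P.submodule = ⊥ := by rw [h, Submodule.span_zero_singleton]
  have h1 := P.finrank_submodule
  rw [h0, finrank_bot] at h1
  exact zero_ne_one h1

theorem IsPt.eq_mk {v : V} {P : ℙ k V} (h : IsPt v P) : P = Projectivization.mk k v h.ne_zero :=
  Projectivization.submodule_injective (by rw [h, Projectivization.submodule_mk])

theorem IsPt.unique {v : V} {P P' : ℙ k V} (h : IsPt v P) (h' : IsPt v P') : P = P' := by
  rw [h.eq_mk, h'.eq_mk]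

theorem exists_isPt (P : ℙ k V) : ∃ v : V, IsPt v P :=
  ⟨P.rep, P.submodule_eq⟩

theorem IsPt.iff_exists_smul {v w : V} {P : ℙ k V} (h : IsPt v P) :
    IsPt w P ↔ ∃ c : k, c ≠ 0 ∧ w = c • v := by
  constructor
  · intro h'
    have e := h.eq_mk.symm.trans h'.eq_mk
    obtain ⟨a, ha⟩ := (Projectivization.mk_eq_mk_iff k v w _ _).1 e
    refine ⟨(a⁻¹ : kˣ), (a⁻¹).ne_zero, ?_⟩
    rw [← ha]
    simp [Units.smul_def]
  · rintro ⟨c, hc, rfl⟩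
    rw [IsPt, h, Submodule.span_singleton_smul_eq (IsUnit.mk0 c hc)]

theorem IsPt.smul {v : V} {P : ℙ k V} (h : IsPt v P) {c : k} (hc : c ≠ 0) : IsPt (c • v) P :=
  h.iff_exists_smul.2 ⟨c, hc, rfl⟩

theorem IsPt.of_smul {v : V} {P : ℙ k V} {c : k} (h : IsPt (c • v) P) : IsPt v P := by
  have hc : c ≠ 0 := by
    rintro rfl
    exact h.ne_zero (zero_smul _ _)
  exact h.iff_exists_smul.2 ⟨c⁻¹, inv_ne_zero hc, (inv_smul_smul₀ hc v).symm⟩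

theorem IsPt.mem_pts_iff {v : V} {P : ℙ k V} (h : IsPt v P) (W : Submodule k V) :
    P ∈ pts k W ↔ v ∈ W := by
  rw [pts, Set.mem_ofPred_eq, h, Submodule.span_singleton_le_iff_mem]

theorem IsPt.map {k' V' : Type*} [Field k'] [AddCommGroup V'] [Module k' V'] {τ : k →+* k'}
    (f : V →ₛₗ[τ] V') (hf : Function.Injective f) {v : V} {P : ℙ k V} (h : IsPt v P) :
    IsPt (f v) (Projectivization.map f hf P) := by
  rw [h.eq_mk, Projectivization.map_mk]
  exact isPt_mk _

end Points

/-! ### Binary forms and their zeros -/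

section BinaryForms

variable {k : Type*} [Field k]

/-- A binary form of degree `d` that vanishes at `d + 1` points of the projective line is zero. -/
theorem coeff_eq_zero_of_vanish {d : ℕ} (g : Fin (d + 1) → k) (a b : Fin (d + 1) → k)
    (hab : Pairwise fun i j => a i * b j ≠ a j * b i)
    (h : ∀ j, ∑ i : Fin (d + 1), a j ^ (d - (i : ℕ)) * b j ^ (i : ℕ) * g i = 0) : g = 0 := by
  -- Evaluation at the points is a projective Vandermonde matrix, whose determinant is the product
  -- of the pairwise 2 × 2 minors. The power of `b` increases with the index, hence the order `b a`.
  have hdet : (Matrix.projVandermonde b a).det ≠ 0 := by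
    rw [Matrix.det_projVandermonde, Finset.prod_ne_zero_iff]
    intro i _
    rw [Finset.prod_ne_zero_iff]
    intro j hj
    have := hab (Finset.mem_Ioi.1 hj).ne
    rw [sub_ne_zero]
    intro e
    exact this (by linear_combination e)
  refine Matrix.eq_zero_of_mulVec_eq_zero hdet (funext fun j => ?_)
  refine Eq.trans (Finset.sum_congr rfl fun i _ => ?_ : _ = ∑ i : Fin (d + 1), _) (h j)
  change Matrix.projVandermonde b a j i * g i = _
  rw [Matrix.projVandermonde_apply, Fin.val_rev]
  have : d + 1 - ((i : ℕ) + 1) = d - i := by omega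
  rw [this]
  ring

/-- `G` is a binary form of degree `d`. -/
def IsForm (d : ℕ) (G : k → k → k) : Prop :=
  ∃ g : Fin (d + 1) → k, ∀ s t, G s t = ∑ i : Fin (d + 1), s ^ (d - (i : ℕ)) * t ^ (i : ℕ) * g i

theorem IsForm.sub {d : ℕ} {G H : k → k → k} (hG : IsForm d G) (hH : IsForm d H) :
    IsForm d fun s t => G s t - H s t := by
  obtain ⟨g, hg⟩ := hG
  obtain ⟨h, hh⟩ := hH
  refine ⟨g - h, fun s t => ?_⟩
  simp only [hg, hh, ← Finset.sum_sub_distrib, Pi.sub_apply, mul_sub]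

theorem IsForm.linear_mul {d : ℕ} {G : k → k → k} (hG : IsForm d G) (a b : k) :
    IsForm (d + 1) fun s t => (a * s + b * t) * G s t := by
  obtain ⟨g, hg⟩ := hG
  -- Multiplication by s keeps the index of a coefficient and appends a zero; multiplication by t
  -- shifts it by one.
  refine ⟨Fin.snoc (α := fun _ => k) (fun i => a * g i) 0 +
    Fin.cons (α := fun _ => k) 0 (fun i => b * g i), fun s t => ?_⟩
  simp only [Pi.add_apply, mul_add, Finset.sum_add_distrib]
  rw [Fin.sum_univ_castSucc, Fin.sum_univ_succ (fun i : Fin (d + 1 + 1) =>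
    s ^ (d + 1 - (i : ℕ)) * t ^ (i : ℕ) * (Fin.cons (α := fun _ => k) 0 (fun i => b * g i) i : k))]
  simp only [Fin.snoc_castSucc, Fin.snoc_last, Fin.cons_zero, Fin.cons_succ, mul_zero, add_zero,
    zero_add, hg, add_mul, Finset.mul_sum, Fin.val_castSucc, Fin.val_succ]
  rw [← Finset.sum_add_distrib]
  refine Finset.sum_congr rfl fun i _ => ?_
  have h1 : d + 1 - (i : ℕ) = d - i + 1 := by omega
  have h2 : d + 1 - ((i : ℕ) + 1) = d - i := by omega
  rw [h1, h2, pow_succ, pow_succ]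
  ring

theorem IsForm.eq_zero {d : ℕ} {G : k → k → k} (hG : IsForm d G) (a b : Fin (d + 1) → k)
    (hab : Pairwise fun i j => a i * b j ≠ a j * b i) (h : ∀ j, G (a j) (b j) = 0) (s t : k) :
    G s t = 0 := by
  obtain ⟨g, hg⟩ := hG
  rw [hg, coeff_eq_zero_of_vanish g a b hab fun j => by rw [← hg, h]]
  simp

end BinaryForms

/-! ### Normal rational curves and their spans -/

section NRC

variable {k V : Type*} [Field k] [AddCommGroup V] [Module k V]

/-- The point with parameters `s, t` of the normal rational curve given by the vectors `e i`. -/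
def nrcVec {d : ℕ} (e : Fin (d + 1) → V) (s t : k) : V :=
  ∑ i : Fin (d + 1), (s ^ (d - (i : ℕ)) * t ^ (i : ℕ)) • e i

theorem isForm_nrcVec {d : ℕ} (e : Fin (d + 1) → V) (l : V →ₗ[k] k) :
    IsForm d fun s t => l (nrcVec e s t) :=
  ⟨fun i => l (e i), fun s t => by simp [nrcVec, map_sum]⟩

theorem nrcVec_smul {d : ℕ} (e : Fin (d + 1) → V) (c s t : k) :
    nrcVec e (c * s) (c * t) = c ^ d • nrcVec e s t := by
  simp only [nrcVec, Finset.smul_sum, smul_smul]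
  refine Finset.sum_congr rfl fun i _ => ?_
  have : c ^ d = c ^ (d - (i : ℕ)) * c ^ (i : ℕ) := by
    rw [← pow_add]
    congr 1
    omega
  rw [this, mul_pow, mul_pow]
  congr 1
  ring

theorem nrcVec_ne_zero {d : ℕ} {e : Fin (d + 1) → V} (he : LinearIndependent k e) {s t : k}
    (h : s ≠ 0 ∨ t ≠ 0) : nrcVec e s t ≠ 0 := by
  intro h0
  have h1 := Fintype.linearIndependent_iff.1 he _ h0
  rcases h with h | h
  · simpa [h] using h1 0
  · simpa [h] using h1 (Fin.last d)

theorem nrcVec_zero {d : ℕ} (hd : d ≠ 0) (e : Fin (d + 1) → V) : nrcVec e (0 : k) 0 = 0 := by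
  refine Finset.sum_eq_zero fun i _ => ?_
  rw [← pow_add, Nat.sub_add_cancel (by omega), zero_pow hd, zero_smul]

/-- Two parameters that are proportional give the same point. -/
theorem isPt_nrcVec_of_det_eq_zero {d : ℕ} (hd : d ≠ 0) {e : Fin (d + 1) → V} {s t s' t' : k}
    {P P' : ℙ k V} (h : IsPt (nrcVec e s t) P) (h' : IsPt (nrcVec e s' t') P')
    (hst : s * t' = s' * t) : P = P' := by
  have hne : ∀ {s t : k} {P : ℙ k V}, IsPt (nrcVec e s t) P → ¬ (s = 0 ∧ t = 0) := by
    rintro s t P h ⟨rfl, rfl⟩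
    exact h.ne_zero (nrcVec_zero hd e)
  have h1 := hne h
  have h2 := hne h'
  obtain ⟨c, hs, ht⟩ : ∃ c, s' = c * s ∧ t' = c * t := by
    by_cases hs : s = 0
    · have ht : t ≠ 0 := fun ht => h1 ⟨hs, ht⟩
      have hs' : s' = 0 := by
        rw [hs, zero_mul] at hst
        exact (mul_eq_zero.1 hst.symm).resolve_right ht
      exact ⟨t' / t, by rw [hs, hs', mul_zero], (div_mul_cancel₀ _ ht).symm⟩
    · refine ⟨s' / s, (div_mul_cancel₀ _ hs).symm, ?_⟩
      field_simp
      linear_combination hst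
  rw [hs, ht, nrcVec_smul] at h'
  exact h.unique h'.of_smul

/-- There are `d + 1` pairwise non-proportional parameters over a field with at least `d`
elements. -/
theorem exists_parameters {d : ℕ} (hd : d ≤ Nat.card k) (hk : Finite k) :
    ∃ a b : Fin (d + 1) → k, Pairwise fun i j => a i * b j ≠ a j * b i := by
  have : Fintype k := Fintype.ofFinite k
  rw [Nat.card_eq_fintype_card, ← Fintype.card_fin d] at hd
  obtain ⟨f⟩ := Function.Embedding.nonempty_of_card_le hd
  -- The point (0, 1) and d points (1, x): the projective line has one point more than the field, so
  -- d ≤ |k| suffices.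
  refine ⟨Fin.cons 0 fun _ => 1, Fin.cons 1 f, fun i j hij => ?_⟩
  induction i using Fin.cases with
  | zero =>
    induction j using Fin.cases with
    | zero => exact absurd rfl hij
    | succ j => simp
  | succ i =>
    induction j using Fin.cases with
    | zero => simp
    | succ j =>
      simp only [Fin.cons_succ, one_mul]
      exact fun h => hij (congrArg Fin.succ (f.injective h.symm))

/-- A subspace containing a normal rational curve contains the vectors that define it. -/
theorem mem_of_nrc_subset {d : ℕ} (hd : d ≤ Nat.card k) (hk : Finite k) {e : Fin (d + 1) → V}
    {W : Submodule k V} (h : ∀ s t : k, nrcVec e s t ∈ W) (i : Fin (d + 1)) : e i ∈ W := by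
  obtain ⟨a, b, hab⟩ := exists_parameters hd hk
  by_contra hi
  -- A functional that kills W but not e i would, along the curve, be a nonzero form of degree d
  -- vanishing everywhere.
  obtain ⟨l, hl, hlW⟩ := Submodule.exists_le_ker_of_notMem hi
  have h0 := coeff_eq_zero_of_vanish (fun i => l (e i)) a b hab fun j => by
    have := hlW (h (a j) (b j))
    rw [LinearMap.mem_ker] at this
    simpa [nrcVec, map_sum] using this
  exact hl (congrFun h0 i)

/-- A normal rational curve spans the same subspace as the vectors that define it. -/
theorem IsNRC.finrank_iSup {d : ℕ} {C : Set (ℙ k V)} (hk : Finite k) (hC : IsNRC k d C) :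
    Module.finrank k (⨆ P ∈ C, P.submodule : Submodule k V) = d + 1 := by
  obtain ⟨hd2, hd, e, he, rfl⟩ := hC
  have : (⨆ P ∈ {P : ℙ k V | ∃ s t : k, IsPt (nrcVec e s t) P}, P.submodule : Submodule k V) =
      Submodule.span k (Set.range e) := by
    apply le_antisymm
    · refine iSup₂_le fun P hP => ?_
      obtain ⟨s, t, h⟩ := hP
      rw [h, Submodule.span_singleton_le_iff_mem]
      exact Submodule.sum_mem _ fun i _ =>
        Submodule.smul_mem _ _ (Submodule.subset_span (Set.mem_range_self i))
    · rw [Submodule.span_le]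
      rintro _ ⟨i, rfl⟩
      refine mem_of_nrc_subset hd hk (fun s t => ?_) i
      by_cases h0 : nrcVec e s t = 0
      · rw [h0]
        exact Submodule.zero_mem _
      · refine (le_iSup₂_of_le (f := fun (P : ℙ k V) (_ : P ∈ {P : ℙ k V | ∃ s t : k,
          IsPt (nrcVec e s t) P}) => P.submodule) (Projectivization.mk k _ h0)
          ⟨s, t, isPt_mk h0⟩ le_rfl) ?_
        rw [Projectivization.submodule_mk]
        exact Submodule.mem_span_singleton_self _
  exact (congrArg (fun W : Submodule k V => Module.finrank k W) this).trans
    ((finrank_span_eq_card he).trans (Fintype.card_fin _))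

theorem IsNRC.degree_unique {d d' : ℕ} {C : Set (ℙ k V)} (hk : Finite k) (h : IsNRC k d C)
    (h' : IsNRC k d' C) : d = d' :=
  Nat.succ_injective ((h.finrank_iSup hk).symm.trans (h'.finrank_iSup hk))

end NRC

/-! ### Subfields as fixed points of powers -/

section Frobenius

/-- The Q elements of L are roots of X^Q - X, which has no more than Q roots. Hence a finite field
has at most one subfield of each order. -/
theorem mem_subfield_iff_pow {K : Type*} [Field K] [Finite K] {L : Subfield K} {Q : ℕ}
    (hL : Nat.card L = Q) (x : K) : x ∈ L ↔ x ^ Q = x := by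
  classical
  have : Fintype L := Fintype.ofFinite L
  rw [Nat.card_eq_fintype_card] at hL
  have hpow : ∀ y : L, (y : K) ^ Q = y := fun y => by
    rw [← hL, ← SubmonoidClass.coe_pow, FiniteField.pow_card]
  refine ⟨fun hx => hpow ⟨x, hx⟩, fun hx => ?_⟩
  have hQ : 1 < Q := hL ▸ Fintype.one_lt_card
  have hne := FiniteField.X_pow_card_sub_X_ne_zero K hQ
  have hsub : Finset.univ.image (fun y : L => (y : K)) ⊆
      (Polynomial.X ^ Q - Polynomial.X : Polynomial K).roots.toFinset := by
    intro z hz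
    obtain ⟨y, -, rfl⟩ := Finset.mem_image.1 hz
    simp [hne, hpow]
  have hcard := Finset.card_image_of_injective (Finset.univ : Finset L) Subtype.val_injective
  have heq := Finset.eq_of_subset_of_card_le hsub (by
    rw [hcard, Finset.card_univ, hL]
    refine (Multiset.toFinset_card_le _).trans ((Polynomial.card_roots' _).trans ?_)
    rw [FiniteField.X_pow_card_sub_X_natDegree_eq K hQ])
  have hx' : x ∈ (Polynomial.X ^ Q - Polynomial.X : Polynomial K).roots.toFinset := by
    simp [hne, hx]
  rw [← heq] at hx'
  obtain ⟨y, -, rfl⟩ := Finset.mem_image.1 hx'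
  exact y.2

variable {F K : Type*} [Field F] [Fintype F] [Field K] [Algebra F K]

theorem card_fieldRange : Nat.card (algebraMap F K).fieldRange = Fintype.card F := by
  rw [← Nat.card_eq_fintype_card]
  exact Nat.card_congr (RingHom.rangeRestrictFieldEquiv (algebraMap F K)).symm.toEquiv

theorem mem_range_iff_pow [Finite K] (x : K) :
    x ∈ Set.range (algebraMap F K) ↔ x ^ Fintype.card F = x := by
  rw [← mem_subfield_iff_pow (card_fieldRange (F := F) (K := K))]
  rfl

theorem pow_card_pow_finrank {n : ℕ} [NeZero n] (hn : Module.finrank F K = n) (x : K) :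
    x ^ Fintype.card F ^ n = x := by
  have : Module.Finite F K := Module.finite_of_finrank_pos (by rw [hn]; exact NeZero.pos n)
  have : Finite K := Module.finite_of_finite F
  have : Fintype K := Fintype.ofFinite K
  rw [← hn, ← Module.card_eq_pow_finrank (K := F) (V := K), FiniteField.pow_card]

end Frobenius

/-! ### Sublines: normal form, inclusion, tangency -/

section Sublines

variable {K : Type*} [Field K]

theorem IsPt.mem_lInf_iff {x : K × K × K} {P : Plane K} (h : IsPt x P) :
    P ∈ lInf K ↔ x.2.2 = 0 := by
  constructor
  · rintro ⟨a, b, hab⟩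
    obtain ⟨c, -, rfl⟩ := hab.iff_exists_smul.1 h
    simp
  · intro h0
    refine ⟨x.1, x.2.1, ?_⟩
    rw [← h0]
    exact h

/-- The subline over `L` defined by the vectors `u` and `v`. -/
def subline (L : Subfield K) (u v : K × K × K) : Set (Plane K) :=
  {P | ∃ s ∈ L, ∃ t ∈ L, IsPt (s • u + t • v) P}

/-- The vector of the affine point `v`. -/
def affVec (v : K × K) : K × K × K := (v.1, v.2, 1)

/-- The vector for which `poleVec v w θ + θ • affVec v` is the point at infinity `w`. -/
def poleVec (v w : K × K) (θ : K) : K × K × K := (w.1 - θ * v.1, w.2 - θ * v.2, -θ)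

theorem subline_smul (L : Subfield K) (u v : K × K × K) {c : K} (hc : c ≠ 0) :
    subline L (c • u) (c • v) = subline L u v := by
  ext P
  have : ∀ s t : K, s • c • u + t • c • v = c • (s • u + t • v) := fun s t => by
    rw [smul_add, smul_comm s c, smul_comm t c]
  simp only [subline, Set.mem_ofPred_eq, this]
  exact ⟨fun ⟨s, hs, t, ht, h⟩ => ⟨s, hs, t, ht, h.of_smul⟩,
    fun ⟨s, hs, t, ht, h⟩ => ⟨s, hs, t, ht, h.smul hc⟩⟩

theorem linearIndependent_pole_aff (v : K × K) {w : K × K} (hw : w ≠ 0) (θ : K) :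
    LinearIndependent K ![poleVec v w θ, affVec v] := by
  rw [LinearIndependent.pair_iff]
  intro s t h
  simp only [poleVec, affVec, Prod.smul_mk, Prod.mk_add_mk, Prod.mk_eq_zero, smul_eq_mul] at h
  obtain ⟨h1, h2, h3⟩ := h
  have ht : t = s * θ := by linear_combination h3
  have hs : s = 0 := by
    by_contra hs
    refine hw (Prod.ext ?_ ?_)
    · refine (mul_eq_zero.1 (?_ : s * w.1 = 0)).resolve_left hs
      rw [ht] at h1
      linear_combination h1
    · refine (mul_eq_zero.1 (?_ : s * w.2 = 0)).resolve_left hs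
      rw [ht] at h2
      linear_combination h2
  exact ⟨hs, by rw [ht, hs, zero_mul]⟩

theorem smul_pole_add_smul_aff (v w : K × K) (θ s t : K) :
    s • poleVec v w θ + t • affVec v =
      (s * w.1 + (t - s * θ) * v.1, s * w.2 + (t - s * θ) * v.2, t - s * θ) := by
  simp only [poleVec, affVec, Prod.smul_mk, Prod.mk_add_mk, smul_eq_mul]
  refine Prod.ext ?_ (Prod.ext ?_ ?_) <;> simp only <;> ring

/-- A subline in normal form that meets the line at infinity is defined over a subfield
containing `θ`. -/
theorem mem_of_mem_lInf {L : Subfield K} {v w : K × K} {θ : K} {P : Plane K}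
    (hP : P ∈ subline L (poleVec v w θ) (affVec v)) (hP' : P ∈ lInf K) :
    θ ∈ L ∧ IsPt (w.1, w.2, (0 : K)) P := by
  obtain ⟨s, hs, t, ht, h⟩ := hP
  rw [smul_pole_add_smul_aff] at h
  have h0 : t - s * θ = 0 := h.mem_lInf_iff.1 hP'
  have hs0 : s ≠ 0 := by
    rintro rfl
    have := h.ne_zero
    rw [h0] at this
    simp at this
  refine ⟨?_, ?_⟩
  · have : θ = t / s := by
      rw [eq_div_iff hs0]
      linear_combination -h0
    rw [this]
    exact L.div_mem ht hs
  · rw [h0] at h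
    refine IsPt.of_smul (c := s) ?_
    simpa using h

theorem external_of_notMem {L : Subfield K} (v w : K × K) {θ : K} (hθ : θ ∉ L) :
    External (subline L (poleVec v w θ) (affVec v)) := by
  rw [External, Set.eq_empty_iff_forall_notMem]
  rintro P ⟨hP, hP'⟩
  exact hθ (mem_of_mem_lInf hP hP').1

theorem tangent_of_mem {L : Subfield K} (v : K × K) {w : K × K} (hw : w ≠ 0) {θ : K}
    (hθ : θ ∈ L) : Tangent (subline L (poleVec v w θ) (affVec v)) := by
  have hw0 : ((w.1, w.2, 0) : K × K × K) ≠ 0 := fun h => hw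
    (Prod.ext (congrArg (fun z : K × K × K => z.1) h) (congrArg (fun z : K × K × K => z.2.1) h))
  rw [Tangent, Set.ncard_eq_one]
  refine ⟨Projectivization.mk K _ hw0, Set.eq_singleton_iff_unique_mem.2 ⟨⟨?_, ?_⟩, ?_⟩⟩
  · refine ⟨1, L.one_mem, θ, hθ, ?_⟩
    rw [smul_pole_add_smul_aff]
    simpa using isPt_mk hw0
  · exact ⟨w.1, w.2, isPt_mk hw0⟩
  · rintro P ⟨hP, hP'⟩
    exact (mem_of_mem_lInf hP hP').2.unique (isPt_mk hw0)

/-- Every external subline can be brought into normal form. -/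
theorem exists_normal_form {L : Subfield K} {u v : K × K × K} (huv : LinearIndependent K ![u, v])
    (hext : External (subline L u v)) :
    ∃ (v' w : K × K) (θ : K), w ≠ 0 ∧ θ ∉ L ∧
      subline L u v = subline L (poleVec v' w θ) (affVec v') := by
  rw [External, Set.eq_empty_iff_forall_notMem] at hext
  -- Being external means that the third coordinate is injective on the L-span of u and v.
  have hfree : ∀ s ∈ L, ∀ t ∈ L, (s • u + t • v).2.2 = 0 → s = 0 ∧ t = 0 := by
    intro s hs t ht h
    refine LinearIndependent.pair_iff.1 huv s t ?_
    by_contra h0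
    exact hext (Projectivization.mk K _ h0) ⟨⟨s, hs, t, ht, isPt_mk h0⟩,
      (isPt_mk h0).mem_lInf_iff.2 h⟩
  have hc : v.2.2 ≠ 0 := fun h =>
    one_ne_zero (hfree 0 L.zero_mem 1 L.one_mem (by simpa using h)).2
  obtain ⟨u1, u2, u3⟩ := u
  obtain ⟨v1, v2, c⟩ := v
  simp only at hc
  -- Dividing both vectors by the last coordinate c of v makes v affine. Then θ = -u3/c, and w is
  -- the point at infinity of the line.
  have hu : ((u1, u2, u3) : K × K × K) = c • poleVec (v1 / c, v2 / c)
      (u1 / c - u3 / c * (v1 / c), u2 / c - u3 / c * (v2 / c)) (-(u3 / c)) := by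
    simp only [poleVec, Prod.smul_mk, smul_eq_mul]
    refine Prod.ext ?_ (Prod.ext ?_ ?_) <;> simp only <;> field_simp <;> ring
  have hv : ((v1, v2, c) : K × K × K) = c • affVec (v1 / c, v2 / c) := by
    simp only [affVec, Prod.smul_mk, smul_eq_mul]
    refine Prod.ext ?_ (Prod.ext ?_ ?_) <;> simp only <;> field_simp
  refine ⟨(v1 / c, v2 / c), (u1 / c - u3 / c * (v1 / c), u2 / c - u3 / c * (v2 / c)), -(u3 / c),
    ?_, ?_, ?_⟩
  · intro h
    rw [Prod.mk_eq_zero] at h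
    refine one_ne_zero (LinearIndependent.pair_iff.1 huv (1 : K) (-(u3 / c)) ?_).1
    simp only [Prod.smul_mk, Prod.mk_add_mk, smul_eq_mul, Prod.mk_eq_zero]
    obtain ⟨h1, h2⟩ := h
    field_simp at h1 h2 ⊢
    exact ⟨by linear_combination h1, by linear_combination h2, by ring⟩
  · intro h
    refine one_ne_zero (hfree 1 L.one_mem _ h ?_).1
    simp only [Prod.smul_mk, Prod.mk_add_mk, smul_eq_mul]
    field_simp
    ring
  · conv_lhs => rw [hu, hv]
    exact subline_smul L _ _ hc

/-- A subline containing the subline defined by `u` and `v` is defined by `u` and `v` over a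
larger field. -/
theorem subline_eq_of_subset {L L' : Subfield K} {u v u' v' : K × K × K}
    (huv : LinearIndependent K ![u, v]) (huv' : LinearIndependent K ![u', v'])
    (h : subline L u v ⊆ subline L' u' v') :
    subline L' u' v' = subline L' u v ∧ L ≤ L' := by
  have hmem : ∀ s ∈ L, ∀ t ∈ L, s • u + t • v ≠ 0 →
      ∃ c : K, c ≠ 0 ∧ ∃ s' ∈ L', ∃ t' ∈ L', s' • u' + t' • v' = c • (s • u + t • v) := by
    intro s hs t ht h0
    obtain ⟨s', hs', t', ht', h'⟩ := h ⟨s, hs, t, ht, isPt_mk h0⟩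
    obtain ⟨c, hc, e⟩ := (isPt_mk h0).iff_exists_smul.1 h'
    exact ⟨c, hc, s', hs', t', ht', e⟩
  have hne : ∀ s t : K, (s ≠ 0 ∨ t ≠ 0) → s • u + t • v ≠ 0 := by
    intro s t hst h0
    obtain ⟨rfl, rfl⟩ := LinearIndependent.pair_iff.1 huv s t h0
    simp at hst
  -- The points u, v and u + v form a frame of the line. Each has a multiple, by a, b and c
  -- respectively, in the L'-span of u' and v'.
  obtain ⟨a, ha, s1, hs1, t1, ht1, e1⟩ :=
    hmem 1 L.one_mem 0 L.zero_mem (hne _ _ (Or.inl one_ne_zero))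
  obtain ⟨b, hb, s2, hs2, t2, ht2, e2⟩ :=
    hmem 0 L.zero_mem 1 L.one_mem (hne _ _ (Or.inr one_ne_zero))
  obtain ⟨c, hc, s3, hs3, t3, ht3, e3⟩ :=
    hmem 1 L.one_mem 1 L.one_mem (hne _ _ (Or.inr one_ne_zero))
  simp only [one_smul, zero_smul, zero_add, add_zero] at e1 e2 e3
  have hcoef : ∀ x y x' y' : K, x • u' + y • v' = x' • u' + y' • v' → x = x' ∧ y = y' := by
    intro x y x' y' e
    have := LinearIndependent.pair_iff.1 huv' (x - x') (y - y') (by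
      rw [sub_smul, sub_smul, ← sub_eq_zero.2 e]
      abel)
    exact ⟨sub_eq_zero.1 this.1, sub_eq_zero.1 this.2⟩
  have hu : u = a⁻¹ • (s1 • u' + t1 • v') := by rw [e1, inv_smul_smul₀ ha]
  have hv : v = b⁻¹ • (s2 • u' + t2 • v') := by rw [e2, inv_smul_smul₀ hb]
  have hδ : s1 * t2 - s2 * t1 ≠ 0 := by
    intro hδ
    have key1 : (t2 * a) • u + (-(t1 * b)) • v = 0 := by
      rw [mul_smul, neg_smul, mul_smul, ← e1, ← e2]
      have : t2 • (s1 • u' + t1 • v') + -(t1 • (s2 • u' + t2 • v')) =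
        (s1 * t2 - s2 * t1) • u' := by module
      rw [this, hδ, zero_smul]
    have key2 : (s2 * a) • u + (-(s1 * b)) • v = 0 := by
      rw [mul_smul, neg_smul, mul_smul, ← e1, ← e2]
      have : s2 • (s1 • u' + t1 • v') + -(s1 • (s2 • u' + t2 • v')) =
        (-(s1 * t2 - s2 * t1)) • v' := by module
      rw [this, hδ, neg_zero, zero_smul]
    obtain ⟨-, h1⟩ := LinearIndependent.pair_iff.1 huv _ _ key1
    obtain ⟨-, h2⟩ := LinearIndependent.pair_iff.1 huv _ _ key2
    have h1' : t1 = 0 := by simpa [hb] using h1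
    have h2' : s1 = 0 := by simpa [hb] using h2
    have : (1 : K) • u + (0 : K) • v = 0 := by
      rw [hu, h1', h2']
      simp
    exact hne 1 0 (Or.inl one_ne_zero) this
  have hδL : s1 * t2 - s2 * t1 ∈ L' := L'.sub_mem (L'.mul_mem hs1 ht2) (L'.mul_mem hs2 ht1)
  obtain ⟨q1, q2⟩ := hcoef s3 t3 (c * a⁻¹ * s1 + c * b⁻¹ * s2) (c * a⁻¹ * t1 + c * b⁻¹ * t2) (by
    rw [e3, hu, hv]
    module)
  -- Cramer's rule over L' gives c/a and c/b, hence a/b: up to a common factor, u and v are an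
  -- L'-basis of the span of u' and v'.
  have hca : c * a⁻¹ ∈ L' := by
    have : c * a⁻¹ = (s3 * t2 - t3 * s2) / (s1 * t2 - s2 * t1) := by
      rw [eq_div_iff hδ, q1, q2]
      ring
    rw [this]
    exact L'.div_mem (L'.sub_mem (L'.mul_mem hs3 ht2) (L'.mul_mem ht3 hs2)) hδL
  have hcb : c * b⁻¹ ∈ L' := by
    have : c * b⁻¹ = (t3 * s1 - s3 * t1) / (s1 * t2 - s2 * t1) := by
      rw [eq_div_iff hδ, q1, q2]
      ring
    rw [this]
    exact L'.div_mem (L'.sub_mem (L'.mul_mem ht3 hs1) (L'.mul_mem hs3 ht1)) hδL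
  have hab : a * b⁻¹ ∈ L' := by
    have : a * b⁻¹ = c * b⁻¹ / (c * a⁻¹) := by field_simp
    rw [this]
    exact L'.div_mem hcb hca
  have hba : b * a⁻¹ ∈ L' := by
    have : b * a⁻¹ = (a * b⁻¹)⁻¹ := by field_simp
    rw [this]
    exact L'.inv_mem hab
  have heq : subline L' u' v' = subline L' u v := by
    ext P
    constructor
    · rintro ⟨s, hs, t, ht, hP⟩
      refine ⟨(s * t2 - t * s2) / (s1 * t2 - s2 * t1), L'.div_mem (L'.sub_mem (L'.mul_mem hs ht2)
        (L'.mul_mem ht hs2)) hδL, b * a⁻¹ * ((t * s1 - s * t1) / (s1 * t2 - s2 * t1)),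
        L'.mul_mem hba (L'.div_mem (L'.sub_mem (L'.mul_mem ht hs1) (L'.mul_mem hs ht1)) hδL), ?_⟩
      refine IsPt.of_smul (c := a) ?_
      convert! hP using 1
      rw [hu, hv]
      obtain ⟨δ, hδe⟩ : ∃ δ, s1 * t2 - s2 * t1 = δ := ⟨_, rfl⟩
      rw [hδe] at hδ ⊢
      match_scalars
      · field_simp
        rw [← hδe]
        ring
      · field_simp
        rw [← hδe]
        ring
    · rintro ⟨s, hs, t, ht, hP⟩
      refine ⟨s * s1 + t * (a * b⁻¹) * s2, L'.add_mem (L'.mul_mem hs hs1)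
        (L'.mul_mem (L'.mul_mem ht hab) hs2), s * t1 + t * (a * b⁻¹) * t2,
        L'.add_mem (L'.mul_mem hs ht1) (L'.mul_mem (L'.mul_mem ht hab) ht2), ?_⟩
      refine IsPt.of_smul (c := a⁻¹) ?_
      convert! hP using 1
      rw [hu, hv]
      match_scalars
      · field_simp
      · field_simp
  -- For t in L, the point u + t v lies on the larger subline; its coordinate ratio t with respect
  -- to u and v is then in L'.
  refine ⟨heq, fun t ht => ?_⟩
  have h0 := hne 1 t (Or.inl one_ne_zero)
  have hP := h ⟨1, L.one_mem, t, ht, isPt_mk h0⟩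
  rw [heq] at hP
  obtain ⟨s', hs', t', ht', h'⟩ := hP
  obtain ⟨d, hd, e⟩ := (isPt_mk h0).iff_exists_smul.1 h'
  have := LinearIndependent.pair_iff.1 huv (s' - d) (t' - d * t) (by
    rw [one_smul] at e
    rw [sub_smul, sub_smul, mul_smul, ← sub_eq_zero.2 e]
    module)
  have e1' := sub_eq_zero.1 this.1
  have e2' := sub_eq_zero.1 this.2
  have : t = t' / s' := by rw [e2', e1', mul_div_cancel_left₀ _ hd]
  rw [this]
  exact L'.div_mem ht' hs'

theorem subline_mono {L L' : Subfield K} (h : L ≤ L') (u v : K × K × K) :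
    subline L u v ⊆ subline L' u v := by
  rintro P ⟨s, hs, t, ht, hP⟩
  exact ⟨s, h hs, t, h ht, hP⟩

/-- The smallest tangent subline over an external subline in normal form is defined over the
smallest field containing `θ`. -/
theorem isSmallestTangentSubline [Finite K] {L L' : Subfield K} (v : K × K) {w : K × K} {θ : K}
    (hw : w ≠ 0) (hLL' : L ≤ L') (hθ : θ ∈ L') (hmin : ∀ M : Subfield K, L ≤ M → θ ∈ M → L' ≤ M) :
    IsSmallestTangentSubline (subline L (poleVec v w θ) (affVec v))
      (subline L' (poleVec v w θ) (affVec v)) := by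
  have hind := linearIndependent_pole_aff v hw θ
  refine ⟨⟨⟨Nat.card L', L', rfl, _, _, hind, rfl⟩, subline_mono hLL' _ _,
    tangent_of_mem v hw hθ⟩, ?_⟩
  rintro m ⟨⟨Q, M, -, u', v', huv', rfl⟩, hsub, htan⟩ hne
  obtain ⟨heq, hLM⟩ := subline_eq_of_subset hind huv' hsub
  change subline M u' v' ≠ _ at hne
  change Tangent (subline M u' v') at htan
  change _ < (subline M u' v').ncard
  rw [heq] at htan hne ⊢
  -- The existence of a point at infinity forces θ into M, so the minimality of L' applies.
  obtain ⟨P, hP⟩ := Set.ncard_eq_one.1 htan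
  have hP' : P ∈ subline M (poleVec v w θ) (affVec v) ∩ lInf K := by rw [hP]; rfl
  have hLM' := hmin M hLM (mem_of_mem_lInf hP'.1 hP'.2).1
  have : Finite (Plane K) := Quotient.finite _
  exact Set.ncard_lt_ncard ((subline_mono hLM' _ _).ssubset_of_ne hne.symm) (Set.toFinite _)

end Sublines

/-! ### The affine curve of an external subline -/

section AffineCurve

variable (F : Type*) {K : Type*} [Field F] [Field K] [Algebra F K]

/-- The points `v` and `v + (t - θ)⁻¹ w`, for `t ∈ F`, of the affine part of `PG(2n, q)`. -/
def affineCurve (v w : K × K) (θ : K) : Set (Sig F K) :=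
  {R | IsPt ((v.1, v.2, 1) : K × K × F) R ∨ ∃ t : F,
    IsPt ((v.1 + w.1 * (algebraMap F K t - θ)⁻¹, v.2 + w.2 * (algebraMap F K t - θ)⁻¹, 1) :
      K × K × F) R}

variable {F}

theorem mem_abbImage_of_external {m : Set (Plane K)} (hm : External m) (R : Sig F K) :
    R ∈ abbImage F K m ↔ ∃ P ∈ m, ∃ a b : K,
      IsPt ((a, b, 1) : K × K × K) P ∧ IsPt ((a, b, 1) : K × K × F) R := by
  simp only [abbImage, Set.mem_iUnion, abb, Set.mem_ofPred_eq, exists_prop]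
  refine exists_congr fun P => and_congr_right fun hP => exists_congr fun a =>
    exists_congr fun b => ⟨?_, Or.inl⟩
  rintro (h | ⟨h, -⟩)
  · exact h
  · have : P ∈ m ∩ lInf K := ⟨hP, a, b, h⟩
    rw [hm] at this
    exact this.elim

theorem abbImage_subline {v w : K × K} {θ : K} (hθ : θ ∉ (algebraMap F K).fieldRange) :
    abbImage F K (subline (algebraMap F K).fieldRange (poleVec v w θ) (affVec v)) =
      affineCurve F v w θ := by
  ext R
  rw [mem_abbImage_of_external (external_of_notMem v w hθ)]
  have hne : ∀ t : F, algebraMap F K t - θ ≠ 0 := fun t h => hθ ⟨t, sub_eq_zero.1 h⟩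
  constructor
  · rintro ⟨P, ⟨_, ⟨s, rfl⟩, _, ⟨t, rfl⟩, hP⟩, a, b, hab, hR⟩
    rw [smul_pole_add_smul_aff] at hP
    obtain ⟨c, hc, e⟩ := hab.iff_exists_smul.1 hP
    simp only [Prod.smul_mk, smul_eq_mul, mul_one, Prod.mk.injEq] at e
    obtain ⟨e1, e2, e3⟩ := e
    by_cases hs : s = 0
    · left
      simp only [hs, map_zero, zero_mul, zero_add, sub_zero] at e1 e2 e3
      have e1' : v.1 = a := mul_left_cancel₀ hc (by rw [← e1, e3])
      have e2' : v.2 = b := mul_left_cancel₀ hc (by rw [← e2, e3])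
      rw [e1', e2']
      exact hR
    · right
      refine ⟨t / s, ?_⟩
      have hs' : algebraMap F K s ≠ 0 := by simpa using hs
      have hts := hne (t / s)
      have hcs : algebraMap F K (t / s) - θ = c / algebraMap F K s := by
        rw [map_div₀, eq_div_iff hs', ← e3]
        field_simp
      have e1' : v.1 + w.1 * (algebraMap F K (t / s) - θ)⁻¹ = a := by
        rw [hcs]
        rw [e3] at e1
        field_simp
        linear_combination e1
      have e2' : v.2 + w.2 * (algebraMap F K (t / s) - θ)⁻¹ = b := by
        rw [hcs]
        rw [e3] at e2
        field_simp
        linear_combination e2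
      rw [e1', e2']
      exact hR
  · have haff : ∀ a b : K, ((a, b, 1) : K × K × K) ≠ 0 := fun a b h =>
      one_ne_zero (congrArg (fun z => z.2.2) h)
    rintro (h | ⟨t, h⟩)
    · refine ⟨_, ⟨0, Subfield.zero_mem _, 1, Subfield.one_mem _, ?_⟩, v.1, v.2,
        isPt_mk (haff _ _), h⟩
      rw [smul_pole_add_smul_aff]
      simpa using isPt_mk (haff v.1 v.2)
    · refine ⟨_, ⟨1, Subfield.one_mem _, algebraMap F K t, ⟨t, rfl⟩, ?_⟩, _, _,
        isPt_mk (haff _ _), h⟩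
      rw [smul_pole_add_smul_aff]
      have h0 := hne t
      convert! (isPt_mk (haff _ _)).smul h0 using 1
      simp only [Prod.smul_mk, smul_eq_mul]
      refine Prod.ext ?_ (Prod.ext ?_ ?_) <;> simp only [one_mul, mul_one] <;> field_simp <;> ring

variable [Fintype F]

theorem fieldRange_eq_of_card [Finite K] {L : Subfield K} (hL : Nat.card L = Fintype.card F) :
    L = (algebraMap F K).fieldRange := by
  ext x
  rw [mem_subfield_iff_pow hL, mem_subfield_iff_pow card_fieldRange]

/-- The ABB-representations of the external sublines of order `q` are the curves
`affineCurve F v w θ`. -/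
theorem exists_external_iff [Finite K] (C : Set (Sig F K)) :
    (∃ m : Set (Plane K), IsSubline K (Fintype.card F) m ∧ External m ∧ C = abbImage F K m) ↔
      ∃ (v w : K × K) (θ : K), w ≠ 0 ∧ θ ∉ (algebraMap F K).fieldRange ∧
        C = affineCurve F v w θ := by
  constructor
  · rintro ⟨m, ⟨L, hL, u, v, huv, rfl⟩, hext, rfl⟩
    obtain rfl := fieldRange_eq_of_card hL
    obtain ⟨v', w, θ, hw, hθ, h⟩ := exists_normal_form huv hext
    refine ⟨v', w, θ, hw, hθ, ?_⟩
    rw [← abbImage_subline hθ, ← h]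
    rfl
  · rintro ⟨v, w, θ, hw, hθ, rfl⟩
    exact ⟨_, ⟨_, card_fieldRange, _, _, linearIndependent_pole_aff v hw θ, rfl⟩,
      external_of_notMem v w hθ, (abbImage_subline hθ).symm⟩

end AffineCurve

/-! ### Quotients of forms with common zeros -/

section FormRelation

variable {k : Type*} [Field k]

theorem pairwise_cons_parameters {d : ℕ} {a b : Fin d → k} {x y : k}
    (hab : Pairwise fun i j => a i * b j ≠ a j * b i) (h : ∀ j, x * b j ≠ a j * y) :
    Pairwise fun i j : Fin (d + 1) => (Fin.cons x a : Fin (d + 1) → k) i *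
      (Fin.cons y b : Fin (d + 1) → k) j ≠ (Fin.cons x a : Fin (d + 1) → k) j *
        (Fin.cons y b : Fin (d + 1) → k) i := by
  intro i j hij
  induction i using Fin.cases with
  | zero =>
    induction j using Fin.cases with
    | zero => exact absurd rfl hij
    | succ j => simpa using h j
  | succ i =>
    induction j using Fin.cases with
    | zero => simpa using (h i).symm
    | succ j =>
      simp only [Fin.cons_succ]
      exact hab fun h => hij (congrArg Fin.succ h)

/-- If `H` vanishes at `d` points and `G` at all but one of them and at a further point, then the
quotient of `G` and `H` is that of two linear forms. -/
theorem form_relation {d : ℕ} {G H : k → k → k} (hG : IsForm d G) (hH : IsForm d H)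
    {a b : Fin d → k} (hab : Pairwise fun i j => a i * b j ≠ a j * b i) (j : Fin d)
    (hGa : ∀ i, i ≠ j → G (a i) (b i) = 0) (hHa : ∀ i, H (a i) (b i) = 0) {s₀ t₀ s₁ t₁ : k}
    (hG0 : G s₀ t₀ = 0) (h0 : ∀ i, s₀ * b i ≠ a i * t₀) (h1 : ∀ i, s₁ * b i ≠ a i * t₁)
    (h10 : s₁ * t₀ ≠ s₀ * t₁) (s t : k) :
    (s₁ * b j - a j * t₁) * G s₁ t₁ * ((s * t₀ - s₀ * t) * H s t) =
      (s₁ * t₀ - s₀ * t₁) * H s₁ t₁ * ((s * b j - a j * t) * G s t) := by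
  -- The difference of the two sides has degree d + 1 and d + 2 zeros: the d points (a i, b i), the
  -- point (s₀, t₀), and (s₁, t₁) by the choice of the constant factors.
  have hform : IsForm (d + 1) fun s t =>
      (((s₁ * b j - a j * t₁) * G s₁ t₁ * t₀) * s +
        (-((s₁ * b j - a j * t₁) * G s₁ t₁ * s₀)) * t) * H s t -
      (((s₁ * t₀ - s₀ * t₁) * H s₁ t₁ * b j) * s +
        (-((s₁ * t₀ - s₀ * t₁) * H s₁ t₁ * a j)) * t) * G s t :=
    (hH.linear_mul _ _).sub (hG.linear_mul _ _)
  have hpair := pairwise_cons_parameters (pairwise_cons_parameters hab h0)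
    (x := s₁) (y := t₁) (fun i => by
      induction i using Fin.cases with
      | zero => simpa using h10
      | succ i => simpa using h1 i)
  have := hform.eq_zero _ _ hpair (fun i => by
    induction i using Fin.cases with
    | zero =>
      simp only [Fin.cons_zero]
      ring
    | succ i =>
      induction i using Fin.cases with
      | zero =>
        simp only [Fin.cons_succ, Fin.cons_zero, hG0]
        ring
      | succ i =>
        simp only [Fin.cons_succ, hHa]
        by_cases hij : i = j
        · subst hij
          ring
        · rw [hGa i hij]
          ring) s t
  linear_combination this

end FormRelation

/-! ### The collineation, residue classes of coordinates, and the indicator set -/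

section Collineation

variable {F K : Type*} [Field F] [Fintype F] [Field K] [Algebra F K] {n : ℕ} [NeZero n]

/-- Indices are cyclic modulo n; since k divides n, the wrap-around respects residues modulo k, so σ
permutes the residue classes cyclically. -/
theorem sub_one_mod {k : ℕ} (hkn : k ∣ n) (i : Fin n) : (((i - 1 : Fin n) : ℕ) + 1) % k = i % k := by
  have h : ((i - 1 + 1 : Fin n) : ℕ) = i := by rw [sub_add_cancel]
  rw [Fin.val_add, Fin.val_one'] at h
  conv_rhs => rw [← h, Nat.mod_mod_of_dvd _ hkn, Nat.add_mod, Nat.mod_mod_of_dvd _ hkn,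
    ← Nat.add_mod]

variable (K n) in
/-- The vectors at infinity whose coordinates vanish outside the residue class of `r`. -/
def classSpace (k r : ℕ) : Submodule K (VStar K n) where
  carrier := {v | v.2.2 = 0 ∧ ∀ i : Fin n, (i : ℕ) % k ≠ r % k → v.1 i = 0 ∧ v.2.1 i = 0}
  zero_mem' := ⟨rfl, fun _ _ => ⟨rfl, rfl⟩⟩
  add_mem' := by
    rintro v w ⟨hv, hv'⟩ ⟨hw, hw'⟩
    refine ⟨by simp [hv, hw], fun i hi => ?_⟩
    simp [hv' i hi, hw' i hi]
  smul_mem' := by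
    rintro c v ⟨hv, hv'⟩
    refine ⟨by simp [hv], fun i hi => ?_⟩
    simp [hv' i hi]

theorem sigmaVec_mem_classSpace {k r : ℕ} (hkn : k ∣ n) {v : VStar K n}
    (hv : v ∈ classSpace K n k r) : sigmaVec F K n v ∈ classSpace K n k (r + 1) := by
  obtain ⟨h0, h⟩ := hv
  have hq : Fintype.card F ≠ 0 := Fintype.card_ne_zero
  refine ⟨?_, fun i hi => ?_⟩
  · change v.2.2 ^ Fintype.card F = 0
    rw [h0, zero_pow hq]
  · obtain ⟨h1, h2⟩ := h (i - 1) (fun e => hi (by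
      rw [← sub_one_mod hkn, Nat.add_mod, e, ← Nat.add_mod]))
    refine ⟨?_, ?_⟩
    · change v.1 (i - 1) ^ Fintype.card F = 0
      rw [h1, zero_pow hq]
    · change v.2.1 (i - 1) ^ Fintype.card F = 0
      rw [h2, zero_pow hq]

theorem sigmaVec_iterate_mem_classSpace {k r : ℕ} (hkn : k ∣ n) {v : VStar K n}
    (hv : v ∈ classSpace K n k r) (j : ℕ) :
    (sigmaVec F K n)^[j] v ∈ classSpace K n k (r + j) := by
  induction j with
  | zero => exact hv
  | succ j ih =>
    rw [Function.iterate_succ_apply']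
    exact sigmaVec_mem_classSpace hkn ih

theorem IsPt.sigma_iterate {v : VStar K n} {P : SigStar K n} (h : IsPt v P) (j : ℕ) :
    IsPt ((sigmaVec F K n)^[j] v) ((sigma F K n)^[j] P) := by
  induction j with
  | zero => exact h
  | succ j ih =>
    rw [Function.iterate_succ_apply', Function.iterate_succ_apply']
    exact ih.map _ (sigmaVec_injective F K n)

theorem sigma_injective : Function.Injective (sigma F K n) := by
  intro P P' h
  obtain ⟨v, hv⟩ := exists_isPt P
  obtain ⟨w, hw⟩ := exists_isPt P'
  have h1 : IsPt (sigmaVec F K n v) (sigma F K n P) := hv.map _ (sigmaVec_injective F K n)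
  have h2 : IsPt (sigmaVec F K n w) (sigma F K n P) := by
    rw [h]
    exact hw.map _ (sigmaVec_injective F K n)
  obtain ⟨c, hc, e⟩ := h1.iff_exists_smul.1 h2
  -- To undo the semilinear map, c must be a q-th power; a nonzero coordinate of v exhibits it as
  -- one.
  obtain ⟨c', rfl⟩ : ∃ c' : K, c' ^ Fintype.card F = c := by
    by_cases hex : ∃ i, v.1 i ≠ 0 ∨ v.2.1 i ≠ 0
    · obtain ⟨i, hi⟩ := hex
      have e1 : w.1 (i + 1 - 1) ^ Fintype.card F = c * v.1 (i + 1 - 1) ^ Fintype.card F :=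
        congrArg (fun z : VStar K n => z.1 (i + 1)) e
      have e2 : w.2.1 (i + 1 - 1) ^ Fintype.card F = c * v.2.1 (i + 1 - 1) ^ Fintype.card F :=
        congrArg (fun z : VStar K n => z.2.1 (i + 1)) e
      rw [add_sub_cancel_right] at e1 e2
      rcases hi with hi | hi
      · exact ⟨w.1 i / v.1 i, by rw [div_pow, e1, mul_div_cancel_right₀ _ (pow_ne_zero _ hi)]⟩
      · exact ⟨w.2.1 i / v.2.1 i, by
          rw [div_pow, e2, mul_div_cancel_right₀ _ (pow_ne_zero _ hi)]⟩
    · push Not at hex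
      have h3 : v.2.2 ≠ 0 := fun h0 => hv.ne_zero (Prod.ext (funext fun i => (hex i).1)
        (Prod.ext (funext fun i => (hex i).2) h0))
      have e3 : w.2.2 ^ Fintype.card F = c * v.2.2 ^ Fintype.card F :=
        congrArg (fun z : VStar K n => z.2.2) e
      exact ⟨w.2.2 / v.2.2, by rw [div_pow, e3, mul_div_cancel_right₀ _ (pow_ne_zero _ h3)]⟩
  have e' : sigmaVec F K n w = sigmaVec F K n (c' • v) := by
    rw [e, map_smulₛₗ]
    rfl
  rw [sigmaVec_injective F K n e'] at hw
  exact hv.unique hw.of_smul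

/-- The line ν involves only the coordinates of index 0, and σ^k preserves residues modulo k, so the
span defining Π is supported on the class of 0; applying σ^j moves it to the class of j. -/
theorem mem_classSpace_of_mem_indicatorPoints {k : ℕ} (hkn : k ∣ n) {P : SigStar K n}
    (hP : P ∈ indicatorPoints F K n k) :
    ∃ j < k, ∀ v, IsPt v P → v ∈ classSpace K n k j := by
  simp only [indicatorPoints, Set.mem_iUnion] at hP
  obtain ⟨j, hj, R, ⟨hR, -⟩, rfl⟩ := hP
  refine ⟨j, hj, fun v hv => ?_⟩
  obtain ⟨u, hu⟩ := exists_isPt R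
  rw [hu.mem_pts_iff] at hR
  have hspan : Submodule.span K {w | ∃ r < n / k, ∃ v ∈ nu K n,
      w = (sigmaVec F K n)^[k * r] v} ≤ classSpace K n k 0 := by
    rw [Submodule.span_le]
    rintro _ ⟨r, -, x, hx, rfl⟩
    have hnu : nu K n ≤ classSpace K n k 0 := by
      have hi : ∀ i : Fin n, (i : ℕ) % k ≠ 0 % k → i ≠ 0 := by
        rintro i hi rfl
        simp at hi
      rw [nu, Submodule.span_le]
      rintro _ (rfl | rfl)
      · exact ⟨rfl, fun i h => ⟨Pi.single_eq_of_ne (hi i h) _, rfl⟩⟩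
      · exact ⟨rfl, fun i h => ⟨rfl, Pi.single_eq_of_ne (hi i h) _⟩⟩
    have := sigmaVec_iterate_mem_classSpace (F := F) hkn (hnu hx) (k * r)
    refine ⟨this.1, fun i hi => this.2 i (by simpa using hi)⟩
  have hu0 := sigmaVec_iterate_mem_classSpace (F := F) hkn (hspan hR) j
  rw [zero_add] at hu0
  obtain ⟨c, -, rfl⟩ := (hu.sigma_iterate (F := F) j).iff_exists_smul.1 hv
  exact Submodule.smul_mem _ _ hu0

theorem pow_val_sub_one (hn : Module.finrank F K = n) (y : K) (i : Fin n) :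
    (y ^ Fintype.card F ^ ((i - 1 : Fin n) : ℕ)) ^ Fintype.card F =
      y ^ Fintype.card F ^ (i : ℕ) := by
  rw [← pow_mul, ← pow_succ]
  obtain ⟨j, rfl⟩ : ∃ j, i = j + 1 := ⟨i - 1, (sub_add_cancel i 1).symm⟩
  rw [add_sub_cancel_right, Fin.val_add, Fin.val_one']
  -- At the wrap-around the exponent q^n acts trivially on the field of q^n elements.
  by_cases hj : (j : ℕ) + 1 = n
  · have h1 : ((j : ℕ) + 1 % n) % n = 0 := by rw [Nat.add_mod_mod, hj, Nat.mod_self]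
    rw [h1, hj, pow_card_pow_finrank hn, pow_zero, pow_one]
  · have h1 : ((j : ℕ) + 1 % n) % n = j + 1 := by
      rw [Nat.add_mod_mod, Nat.mod_eq_of_lt (by omega)]
    rw [h1]

theorem sigmaVec_iotaVec (hn : Module.finrank F K = n) (x : K × K × F) :
    sigmaVec F K n (iotaVec F K n x) = iotaVec F K n x := by
  refine Prod.ext (funext fun i => pow_val_sub_one hn _ _) (Prod.ext (funext fun i => pow_val_sub_one hn _ _) ?_)
  have := algebraMap_pow_q F (K := K) 1 x.2.2
  rwa [pow_one] at this

theorem sigma_iota (hn : Module.finrank F K = n) (R : Sig F K) :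
    sigma F K n (iota F K n R) = iota F K n R := by
  obtain ⟨x, hx⟩ := exists_isPt R
  have h1 : IsPt (iotaVec F K n x) (iota F K n R) := hx.map _ (iotaVec_injective F K n)
  have h2 := h1.map _ (sigmaVec_injective F K n)
  rw [sigmaVec_iotaVec hn] at h2
  exact h2.unique h1

/-- A coordinate on the affine line through `v` in direction `w`, after the `i`-th power of the
Frobenius map, extends to a functional depending only on the `i`-th coordinates and the last. -/
theorem exists_functional (v : K × K) {w : K × K} (hw : w ≠ 0) (i : Fin n) :
    ∃ l : VStar K n →ₗ[K] K,
      (∀ y : K, l (iotaVec F K n (v.1 + w.1 * y, v.2 + w.2 * y, 1)) =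
        y ^ Fintype.card F ^ (i : ℕ)) ∧
      ∀ z : VStar K n, z.1 i = 0 → z.2.1 i = 0 → z.2.2 = 0 → l z = 0 := by
  by_cases h1 : w.1 = 0
  · have h2 : w.2 ≠ 0 := fun h2 => hw (Prod.ext h1 h2)
    refine ⟨((w.2 ^ Fintype.card F ^ (i : ℕ))⁻¹) • (LinearMap.proj i ∘ₗ
      LinearMap.fst K (Fin n → K) K ∘ₗ LinearMap.snd K (Fin n → K) _ -
      (v.2 ^ Fintype.card F ^ (i : ℕ)) • (LinearMap.snd K (Fin n → K) K ∘ₗ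
        LinearMap.snd K (Fin n → K) _)), fun y => ?_, fun z hz1 hz2 hz => ?_⟩
    · simp only [LinearMap.smul_apply, LinearMap.sub_apply, LinearMap.comp_apply,
        LinearMap.proj_apply, LinearMap.fst_apply, LinearMap.snd_apply, iotaVec, LinearMap.coe_mk,
        AddHom.coe_mk, smul_eq_mul, map_one, mul_one, add_pow_q, mul_pow]
      rw [add_sub_cancel_left, inv_mul_cancel_left₀ (pow_ne_zero _ h2)]
    · simp [hz2, hz]
  · refine ⟨((w.1 ^ Fintype.card F ^ (i : ℕ))⁻¹) • (LinearMap.proj i ∘ₗ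
      LinearMap.fst K (Fin n → K) _ -
      (v.1 ^ Fintype.card F ^ (i : ℕ)) • (LinearMap.snd K (Fin n → K) K ∘ₗ
        LinearMap.snd K (Fin n → K) _)), fun y => ?_, fun z hz1 hz2 hz => ?_⟩
    · simp only [LinearMap.smul_apply, LinearMap.sub_apply, LinearMap.comp_apply,
        LinearMap.proj_apply, LinearMap.fst_apply, LinearMap.snd_apply, iotaVec, LinearMap.coe_mk,
        AddHom.coe_mk, smul_eq_mul, map_one, mul_one, add_pow_q, mul_pow]
      rw [add_sub_cancel_left, inv_mul_cancel_left₀ (pow_ne_zero _ h1)]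
    · simp [hz1, hz]

theorem IsPt.mem_hInf_iff {x : K × K × F} {P : Sig F K} (h : IsPt x P) :
    P ∈ hInf F K ↔ x.2.2 = 0 := by
  constructor
  · rintro ⟨a, b, hab⟩
    obtain ⟨c, -, rfl⟩ := hab.iff_exists_smul.1 h
    simp
  · intro h0
    refine ⟨x.1, x.2.1, ?_⟩
    rw [← h0]
    exact h

theorem sub_pow_q (i : ℕ) (x y : K) :
    (x - y) ^ (Fintype.card F ^ i) = x ^ (Fintype.card F ^ i) - y ^ (Fintype.card F ^ i) := by
  rw [eq_sub_iff_add_eq, ← add_pow_q, sub_add_cancel]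

variable (F K) in
/-- The elements `x` with `x ^ q ^ k = x`. -/
def frobFixed (k : ℕ) : Submodule F K where
  carrier := {x | x ^ (Fintype.card F ^ k) = x}
  zero_mem' := zero_pow (pow_ne_zero _ Fintype.card_ne_zero)
  add_mem' := by
    intro x y hx hy
    change (x + y) ^ _ = _
    rw [add_pow_q, hx, hy]
  smul_mem' := by
    intro c x hx
    change (c • x) ^ _ = _
    rw [Algebra.smul_def, mul_pow, algebraMap_pow_q, hx]

/-- The fixed elements are roots of X^(q^k) - X, so there are at most q^k of them. -/
theorem finrank_frobFixed_le [Finite K] {k : ℕ} (hk : k ≠ 0) :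
    Module.finrank F (frobFixed F K k) ≤ k := by
  classical
  have : Fintype (frobFixed F K k) := Fintype.ofFinite _
  have hq : 1 < Fintype.card F := Fintype.one_lt_card
  refine (Nat.pow_le_pow_iff_right hq).1 ?_
  rw [← Module.card_eq_pow_finrank (K := F) (V := frobFixed F K k)]
  have hQ : 1 < Fintype.card F ^ k := Nat.one_lt_pow hk hq
  rw [← FiniteField.X_pow_card_sub_X_natDegree_eq K hQ]
  refine le_trans ?_ ((Multiset.toFinset_card_le _).trans (Polynomial.card_roots' _))
  rw [← Finset.card_univ, ← Finset.card_image_of_injective _ (Subtype.val_injective :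
    Function.Injective fun x : frobFixed F K k => (x : K))]
  refine Finset.card_le_card fun z hz => ?_
  obtain ⟨⟨x, hx⟩, -, rfl⟩ := Finset.mem_image.1 hz
  have hx' : x ^ (Fintype.card F ^ k) = x := hx
  simp [FiniteField.X_pow_card_sub_X_ne_zero K hQ, hx']

end Collineation

/-! ### A normal rational curve has more than q points -/

section Count

variable {k V : Type*} [Field k] [Fintype k] [AddCommGroup V] [Module k V]

theorem IsNRC.card_lt_ncard [Finite (ℙ k V)] {d : ℕ} {C : Set (ℙ k V)} (hC : IsNRC k d C) :
    Fintype.card k < C.ncard := by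
  obtain ⟨hd, -, e, he, rfl⟩ := hC
  have h0 := nrcVec_ne_zero he (s := 0) (t := 1) (Or.inr one_ne_zero)
  have h1 : ∀ t : k, nrcVec e 1 t ≠ 0 := fun t => nrcVec_ne_zero he (Or.inl one_ne_zero)
  have hcoef : ∀ {c s t s' t' : k}, nrcVec e s t = c • nrcVec e s' t' → ∀ i : Fin (d + 1),
      s ^ (d - (i : ℕ)) * t ^ (i : ℕ) = c * (s' ^ (d - (i : ℕ)) * t' ^ (i : ℕ)) := by
    intro c s t s' t' h i
    have := Fintype.linearIndependent_iff.1 he (fun i : Fin (d + 1) =>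
      s ^ (d - (i : ℕ)) * t ^ (i : ℕ) - c * (s' ^ (d - (i : ℕ)) * t' ^ (i : ℕ))) (by
        simp only [sub_smul, Finset.sum_sub_distrib, mul_smul c, ← Finset.smul_sum]
        exact sub_eq_zero.2 h) i
    exact sub_eq_zero.1 this
  have hinf : ∀ t : k, Projectivization.mk k _ h0 ≠ Projectivization.mk k _ (h1 t) := by
    intro t h
    have h2 := isPt_mk (k := k) h0
    rw [h] at h2
    obtain ⟨c, hc, e⟩ := h2.iff_exists_smul.1 (isPt_mk (h1 t))
    have := hcoef e 0
    simp only [Fin.val_zero, Nat.sub_zero, one_pow, pow_zero, zero_pow (by omega : d ≠ 0)] at this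
    simp at this
  have hinj : Function.Injective fun t : k => Projectivization.mk k _ (h1 t) := by
    intro t t' h
    have h2 := isPt_mk (k := k) (h1 t)
    simp only at h
    rw [h] at h2
    obtain ⟨c, hc, e⟩ := h2.iff_exists_smul.1 (isPt_mk (h1 t'))
    have e0 := hcoef e 0
    have e1 := hcoef e ⟨1, by omega⟩
    simp only [Fin.val_zero, one_pow, pow_zero, one_mul, mul_one, pow_one] at e0 e1
    rw [← e0, one_mul] at e1
    exact e1.symm
  let f : Option k → ℙ k V := fun o => o.elim (Projectivization.mk k _ h0) fun t =>
    Projectivization.mk k _ (h1 t)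
  have hf : Function.Injective f := by
    rintro (_ | t) (_ | t') h
    · rfl
    · exact (hinf t' h).elim
    · exact (hinf t h.symm).elim
    · exact congrArg some (hinj h)
  have hrange : Set.range f ⊆ {P | ∃ s t : k, IsPt (nrcVec e s t) P} := by
    rintro _ ⟨_ | t, rfl⟩
    · exact ⟨0, 1, isPt_mk h0⟩
    · exact ⟨1, t, isPt_mk (h1 t)⟩
  have := Set.ncard_le_ncard hrange (Set.toFinite _)
  rw [← Set.image_univ, Set.ncard_image_of_injective _ hf, Set.ncard_univ, Nat.card_eq_fintype_card,
    Fintype.card_option] at this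
  exact this

end Count

/-! ### From conditions (i) and (ii) to a curve in normal form -/

section Reconstruction

variable {F K : Type*} [Field F] [Fintype F] [Field K] [Algebra F K]

/-- A set of more than `q` points on an affine line whose inverse coordinates satisfy an equation
`Y ^ q = A Y + B` is a curve in normal form. -/
theorem exists_eq_affineCurve [Finite K] {C : Set (Sig F K)} (hC : Fintype.card F < C.ncard)
    {v w : K × K} (hw : w ≠ 0) {P : Sig F K} (hP : IsPt ((v.1, v.2, 1) : K × K × F) P)
    (hPC : P ∈ C) (A B : K) (h : ∀ R ∈ C, R ≠ P → ∃ Y : K, Y ≠ 0 ∧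
      Y ^ Fintype.card F = A * Y + B ∧
      IsPt ((v.1 + w.1 * Y⁻¹, v.2 + w.2 * Y⁻¹, 1) : K × K × F) R) :
    ∃ (v w : K × K) (θ : K), w ≠ 0 ∧ θ ∉ (algebraMap F K).fieldRange ∧
      C = affineCurve F v w θ := by
  have : Finite (Sig F K) := Quotient.finite _
  have hcard : Fintype.card F ≤ (C \ {P}).ncard := by
    rw [Set.ncard_sdiff_singleton_of_mem hPC]
    omega
  have hq : 1 < Fintype.card F := Fintype.one_lt_card
  obtain ⟨R₀, hR₀, R₁, hR₁, hne⟩ := (Set.one_lt_ncard (Set.toFinite _)).1 (hq.trans_le hcard)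
  obtain ⟨Y₀, hY₀, e₀, hp₀⟩ := h R₀ hR₀.1 hR₀.2
  obtain ⟨Y₁, hY₁, e₁, hp₁⟩ := h R₁ hR₁.1 hR₁.2
  have hd : Y₁ - Y₀ ≠ 0 := by
    intro h0
    rw [sub_eq_zero.1 h0] at hp₁
    exact hne (hp₀.unique hp₁)
  obtain ⟨d, hde⟩ : ∃ d, Y₁ - Y₀ = d := ⟨_, rfl⟩
  rw [hde] at hd
  have hsub : ∀ x y : K, (x - y) ^ Fintype.card F = x ^ Fintype.card F - y ^ Fintype.card F := by
    intro x y
    have := sub_pow_q (F := F) 1 x y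
    rwa [pow_one] at this
  have hdq : d ^ Fintype.card F = A * d := by
    rw [← hde, hsub, e₀, e₁]
    ring
  have hpar : ∀ R ∈ C \ {P}, ∃ t : F, algebraMap F K t * d + Y₀ ≠ 0 ∧
      IsPt ((v.1 + w.1 * (algebraMap F K t * d + Y₀)⁻¹,
        v.2 + w.2 * (algebraMap F K t * d + Y₀)⁻¹, 1) : K × K × F) R := by
    intro R hR
    obtain ⟨Y, hY, e, hp⟩ := h R hR.1 hR.2
    have hA : A ≠ 0 := by
      rintro rfl
      rw [zero_mul] at hdq
      exact pow_ne_zero _ hd hdq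
    -- Differences of solutions of Y^q = A Y + B satisfy x^q = A x, so the quotient of two of them
    -- is fixed by the Frobenius map.
    obtain ⟨t, ht⟩ : (Y - Y₀) / d ∈ Set.range (algebraMap F K) := by
      rw [mem_range_iff_pow, div_pow, hsub, e, e₀, hdq]
      field_simp
      ring
    have hYt : algebraMap F K t * d + Y₀ = Y := by
      rw [ht]
      field_simp
      ring
    exact ⟨t, by rwa [hYt], by rwa [hYt]⟩
  choose! T hT0 hT using hpar
  have hinj : Set.InjOn T (C \ {P}) := by
    intro R hR R' hR' e
    have := hT R hR
    rw [e] at this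
    exact this.unique (hT R' hR')
  -- The parameter T determines the point, and at least q points remain besides P, so every element
  -- of `F` occurs.
  have hsurj : T '' (C \ {P}) = Set.univ := by
    refine Set.eq_of_subset_of_ncard_le (Set.subset_univ _) ?_ (Set.toFinite _)
    rw [hinj.ncard_image, Set.ncard_univ, Nat.card_eq_fintype_card]
    exact hcard
  have hall : ∀ t : F, ∃ R ∈ C \ {P}, T R = t := by
    intro t
    have : t ∈ T '' (C \ {P}) := hsurj ▸ Set.mem_univ t
    exact this
  have hconv : ∀ (t : F) (x : K), x / d * (algebraMap F K t - -Y₀ / d)⁻¹ =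
      x * (algebraMap F K t * d + Y₀)⁻¹ := by
    intro t x
    have : algebraMap F K t - -Y₀ / d = (algebraMap F K t * d + Y₀) / d := by
      field_simp
      ring
    rw [this, inv_div]
    field_simp
  -- Here Y = t d + Y₀ = d (t - θ) with θ = -Y₀/d. If θ were in `F`, the point with parameter θ
  -- would have Y = 0.
  refine ⟨v, (w.1 / d, w.2 / d), -Y₀ / d, ?_, ?_, ?_⟩
  · intro h0
    rw [Prod.mk_eq_zero, div_eq_zero_iff, div_eq_zero_iff, or_iff_left hd, or_iff_left hd] at h0
    exact hw (Prod.ext h0.1 h0.2)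
  · rintro ⟨t, ht⟩
    obtain ⟨R, hR, rfl⟩ := hall t
    refine hT0 R hR ?_
    rw [ht]
    field_simp
    ring
  · ext R
    simp only [affineCurve, Set.mem_ofPred_eq, hconv]
    constructor
    · intro hR
      by_cases hRP : R = P
      · left
        rw [hRP]
        exact hP
      · exact Or.inr ⟨T R, hT R ⟨hR, hRP⟩⟩
    · rintro (hR | ⟨t, hR⟩)
      · rw [hR.unique hP]
        exact hPC
      · obtain ⟨R', hR', rfl⟩ := hall t
        rw [hR.unique (hT R' hR')]
        exact hR'.1

variable {n : ℕ} [NeZero n]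

/-- A curve of degree `k` in a `k`-space that meets the hyperplane at infinity in an element of
the subspread is not contained in that hyperplane. -/
theorem exists_notMem_hInf [Finite K] {k : ℕ} {C : Set (Sig F K)} (hC : IsNRC F k C)
    {W : Submodule F (K × K × F)} (hCW : C ⊆ pts F W) {a b : K}
    (hW : ∀ x ∈ W, x.2.2 = 0 → ∃ y ∈ frobFixed F K k, x = (a * y, b * y, 0)) :
    ∃ R ∈ C, R ∉ hInf F K := by
  by_contra! hall
  obtain ⟨hk, hkq, e, he, rfl⟩ := hC
  have hmem : ∀ s t : F, nrcVec e s t ∈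
      W ⊓ LinearMap.ker (LinearMap.snd F K F ∘ₗ LinearMap.snd F K (K × F)) := by
    intro s t
    by_cases h0 : nrcVec e s t = 0
    · rw [h0]
      exact Submodule.zero_mem _
    · have hpt := isPt_mk (k := F) h0
      exact ⟨(hpt.mem_pts_iff W).1 (hCW ⟨s, t, hpt⟩), (hpt.mem_hInf_iff).1 (hall _ ⟨s, t, hpt⟩)⟩
  -- Otherwise all k + 1 independent vectors of the curve would lie in the image of a space of
  -- dimension at most k.
  have hei : ∀ i, ∃ y ∈ frobFixed F K k, e i = (a * y, b * y, 0) := fun i => by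
    obtain ⟨h1, h2⟩ := mem_of_nrc_subset hkq inferInstance hmem i
    exact hW _ h1 h2
  choose y hy hey using hei
  let y' : Fin (k + 1) → frobFixed F K k := fun i => ⟨y i, hy i⟩
  have hlin : LinearIndependent F y' := by
    rw [Fintype.linearIndependent_iff]
    intro g hg
    refine Fintype.linearIndependent_iff.1 he g ?_
    have hg' : ∑ i, g i • y i = 0 := by
      have := congrArg (fun z : frobFixed F K k => (z : K)) hg
      simpa [y'] using this
    let L : K →ₗ[F] K × K × F := (LinearMap.mulLeft F a).prod ((LinearMap.mulLeft F b).prod 0)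
    have hL : ∀ i, e i = L (y i) := hey
    simp only [hL, ← map_smul, ← map_sum]
    rw [hg', map_zero]
  have h1 := hlin.fintype_card_le_finrank
  rw [Fintype.card_fin] at h1
  have h2 := finrank_frobFixed_le (F := F) (K := K) (k := k) (by omega)
  omega

/-- The last coordinate of `Σ*`. -/
def lastCoord (K : Type*) [Field K] (n : ℕ) : VStar K n →ₗ[K] K :=
  LinearMap.snd K (Fin n → K) K ∘ₗ LinearMap.snd K (Fin n → K) _

/-- By injectivity of σ, a fixed conjugate would give Q^σ = Q. Thus the points of ι(C), which σ
fixes, are never conjugates of Q. -/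
theorem sigma_iterate_inj {k : ℕ} {Q : SigStar K n}
    (hQ : Set.InjOn (fun j => (sigma F K n)^[j] Q) (Set.Iio k)) (hk : 2 ≤ k) (j : ℕ) :
    sigma F K n ((sigma F K n)^[j] Q) ≠ (sigma F K n)^[j] Q := by
  intro h
  rw [← Function.iterate_succ_apply' (sigma F K n), Function.iterate_succ_apply] at h
  have := hQ (show 1 < k by omega) (show 0 < k by omega) (sigma_injective.iterate j h)
  exact one_ne_zero this

/-- Conjugate points on the indicator set lie in different residue classes. -/
theorem exists_index {k : ℕ} (hkn : k ∣ n) {Q : SigStar K n} (hQ : Q ∈ indicatorPoints F K n k)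
    (i : Fin n) : ∃ j : Fin k, ∀ j' : Fin k, j' ≠ j → ∀ z,
      IsPt z ((sigma F K n)^[j'] Q) → z.1 i = 0 ∧ z.2.1 i = 0 := by
  obtain ⟨j₀, hj₀, hcl⟩ := mem_classSpace_of_mem_indicatorPoints hkn hQ
  obtain ⟨u, hu⟩ := exists_isPt Q
  have hk : 0 < k := by omega
  -- Q lies in the class of j₀, so its j-th conjugate lies in the class of j₀ + j, and i belongs to
  -- that class only for j ≡ i - j₀.
  refine ⟨⟨((i : ℕ) + (k - j₀)) % k, Nat.mod_lt _ hk⟩, fun j' hj' z hz => ?_⟩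
  obtain ⟨c, -, rfl⟩ := (hu.sigma_iterate (F := F) j').iff_exists_smul.1 hz
  have h1 := sigmaVec_iterate_mem_classSpace (F := F) hkn (hcl u hu) j'
  refine (Submodule.smul_mem _ c h1).2 i fun e => hj' (Fin.ext ?_)
  change (j' : ℕ) = ((i : ℕ) + (k - j₀)) % k
  rw [Nat.add_mod, e, ← Nat.add_mod]
  have : j₀ + (j' : ℕ) + (k - j₀) = j' + k := by omega
  rw [this, Nat.add_mod_right, Nat.mod_eq_of_lt j'.2]

/-- Elimination of the curve parameter: l₀, l₁ and L are linear forms in two variables, hence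
dependent (hypothesis `h`). Dividing by L turns this dependence into an affine relation between 1/y
and 1/y^q. -/
theorem inv_pow_relation {k : Type*} [Field k] {m₀ m₁ M d₀ d₁ D L l₀ l₁ y z z' : k} {q : ℕ}
    (hL : L ≠ 0) (hy : y ≠ 0) (hz' : z' ≠ 0) (hm₁ : m₁ ≠ 0) (hd₀ : d₀ ≠ 0)
    (h₀ : m₀ * z * L = M * (l₀ * y)) (h₁ : m₁ * z' * L = M * (l₁ * y ^ q))
    (h : d₀ * l₁ = d₁ * l₀ + D * L) :
    y⁻¹ ^ q = d₁ / d₀ * m₀ * z / (m₁ * z') * y⁻¹ + M * (D / d₀) / (m₁ * z') := by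
  have hyq := pow_ne_zero q hy
  have e : d₀ * m₁ * z' * y = d₁ * m₀ * z * y ^ q + M * D * (y ^ q * y) := by
    refine mul_left_cancel₀ hL ?_
    linear_combination d₀ * y * h₁ - d₁ * y ^ q * h₀ + M * y ^ q * y * h
  rw [inv_pow]
  field_simp
  linear_combination e

theorem exists_affineCurve_of_cond (hn : Module.finrank F K = n) {k : ℕ} (hkn : k ∣ n)
    {C : Set (Sig F K)} (hI : CondI F K k C) (hII : CondII F K n k C) :
    ∃ (v w : K × K) (θ : K), w ≠ 0 ∧ θ ∉ (algebraMap F K).fieldRange ∧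
      C = affineCurve F v w θ := by
  have : Module.Finite F K := Module.finite_of_finrank_pos (by rw [hn]; exact NeZero.pos n)
  have : Finite K := Module.finite_of_finite F
  have : Finite (Sig F K) := Quotient.finite _
  obtain ⟨hC, W, -, hCW, a, b, hab, hWD⟩ := hI
  have hk : 2 ≤ k := hC.1
  have hkn' : k ≤ n := Nat.le_of_dvd (NeZero.pos n) hkn
  obtain ⟨Cs, ⟨⟨-, -, f, hf, rfl⟩, hsub⟩, Q, hQinj, hQ⟩ := hII
  have hd : k ≠ 0 := by omega
  have hQmem : ∀ j : Fin k, (∃ s t : K, IsPt (nrcVec f s t) ((sigma F K n)^[j] Q)) ∧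
      (sigma F K n)^[j] Q ∈ indicatorPoints F K n k := by
    intro j
    have : (sigma F K n)^[j] Q ∈ (fun j => (sigma F K n)^[j] Q) '' Set.Iio k := ⟨j, j.2, rfl⟩
    rw [← hQ] at this
    exact this
  choose α β hαβ using fun j => (hQmem j).1
  have hQ0 : Q ∈ indicatorPoints F K n k := (hQmem ⟨0, by omega⟩).2
  have hpair : Pairwise fun i j => α i * β j ≠ α j * β i := by
    intro i j hij h
    have := isPt_nrcVec_of_det_eq_zero hd (hαβ i) (hαβ j) h
    exact hij (Fin.ext (hQinj i.2 j.2 this))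
  have hlast : ∀ j, lastCoord K n (nrcVec f (α j) (β j)) = 0 := by
    intro j
    obtain ⟨r, -, hr⟩ := mem_classSpace_of_mem_indicatorPoints hkn (hQmem j).2
    exact (hr _ (hαβ j)).1
  have hWpts : ∀ x ∈ W, x.2.2 = 0 → ∃ y ∈ frobFixed F K k, x = (a * y, b * y, 0) := by
    intro x hx hx0
    by_cases h0 : x = 0
    · exact ⟨0, Submodule.zero_mem _, by rw [h0, mul_zero, mul_zero]; rfl⟩
    · have hpt := isPt_mk (k := F) h0
      have : Projectivization.mk F x h0 ∈ pts F W ∩ hInf F K :=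
        ⟨(hpt.mem_pts_iff W).2 hx, hpt.mem_hInf_iff.2 hx0⟩
      rw [hWD] at this
      obtain ⟨y, hy, -, hy'⟩ := this
      obtain ⟨c, -, e⟩ := hy'.iff_exists_smul.1 hpt
      refine ⟨c • y, Submodule.smul_mem _ c hy, ?_⟩
      rw [e, Prod.smul_mk, Prod.smul_mk, mul_smul_comm, mul_smul_comm, smul_zero]
  have hparam : ∀ R ∈ C, ∃ s t : K, IsPt (nrcVec f s t) (iota F K n R) ∧
      ∀ j, s * β j ≠ α j * t := by
    intro R hR
    obtain ⟨s, t, hst⟩ := hsub ⟨R, hR, rfl⟩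
    refine ⟨s, t, hst, fun j h => sigma_iterate_inj hQinj hk j ?_⟩
    rw [← isPt_nrcVec_of_det_eq_zero hd hst (hαβ j) h, sigma_iota hn]
  obtain ⟨P, hPC, hPinf⟩ := exists_notMem_hInf hC hCW hWpts
  have haff : ∀ R ∈ C, ∃ x : K × K, IsPt ((x.1, x.2, 1) : K × K × F) R := by
    intro R hR
    obtain ⟨x, hx⟩ := exists_isPt R
    have hx0 : x.2.2 ≠ 0 := by
      intro hx0
      obtain ⟨s, t, hst, hne⟩ := hparam R hR
      obtain ⟨s', t', hst', -⟩ := hparam P hPC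
      obtain ⟨y, hy⟩ := exists_isPt P
      -- A point of C at infinity would be a (k + 1)-st zero of the last coordinate, which would
      -- then vanish identically, contradicting that P is affine.
      have hzero := (isForm_nrcVec f (lastCoord K n)).eq_zero _ _
        (pairwise_cons_parameters hpair hne) (fun i => by
          induction i using Fin.cases with
          | zero =>
            obtain ⟨c, -, e⟩ := (hx.map _ (iotaVec_injective F K n)).iff_exists_smul.1 hst
            simp only [Fin.cons_zero]
            rw [e]
            have : lastCoord K n (iotaVec F K n x) = algebraMap F K x.2.2 := rfl
            rw [map_smul, this, hx0, map_zero, smul_zero]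
          | succ i => simpa using hlast i) s' t'
      obtain ⟨c, hc, e⟩ := (hy.map _ (iotaVec_injective F K n)).iff_exists_smul.1 hst'
      have : lastCoord K n (iotaVec F K n y) = algebraMap F K y.2.2 := rfl
      rw [e, map_smul, this, smul_eq_mul, mul_eq_zero, or_iff_right hc, map_eq_zero] at hzero
      exact hPinf (hy.mem_hInf_iff.2 hzero)
    refine ⟨(x.2.2⁻¹ • x.1, x.2.2⁻¹ • x.2.1), ?_⟩
    convert! hx.smul (inv_ne_zero hx0) using 1
    refine Prod.ext rfl (Prod.ext rfl ?_)
    exact (inv_mul_cancel₀ hx0).symm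
  have hiota : ∀ R ∈ C, ∀ R' ∈ C, iota F K n R = iota F K n R' → R = R' := by
    intro R hR R' hR' h
    obtain ⟨x, hx⟩ := haff R hR
    obtain ⟨x', hx'⟩ := haff R' hR'
    have h1 := hx.map _ (iotaVec_injective F K n)
    have h2 := hx'.map _ (iotaVec_injective F K n)
    rw [← iota, h] at h1
    obtain ⟨c, -, e⟩ := h1.iff_exists_smul.1 h2
    have hc : algebraMap F K 1 = c * algebraMap F K 1 :=
      congrArg (fun z : VStar K n => z.2.2) e
    rw [map_one, mul_one] at hc
    rw [← hc, one_smul] at e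
    rw [← iotaVec_injective F K n e] at hx
    exact hx.unique hx'
  obtain ⟨v, hv⟩ := haff P hPC
  have hw : ((a, b) : K × K) ≠ 0 := hab
  have hline : ∀ R ∈ C, ∃ y : K, IsPt ((v.1 + a * y, v.2 + b * y, 1) : K × K × F) R := by
    intro R hR
    obtain ⟨x, hx⟩ := haff R hR
    obtain ⟨y, -, hy⟩ := hWpts ((x.1, x.2, 1) - (v.1, v.2, 1))
      (W.sub_mem ((hx.mem_pts_iff W).1 (hCW hR)) ((hv.mem_pts_iff W).1 (hCW hPC)))
      (sub_self _)
    refine ⟨y, ?_⟩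
    have h1 : x.1 - v.1 = a * y := congrArg (fun z : K × K × F => z.1) hy
    have h2 : x.2 - v.2 = b * y := congrArg (fun z : K × K × F => z.2.1) hy
    rw [← h1, ← h2, add_sub_cancel, add_sub_cancel]
    exact hx
  obtain ⟨s₀, t₀, hst₀, hne₀⟩ := hparam P hPC
  obtain ⟨R₁, hR₁, hR₁P⟩ := Set.exists_ne_of_one_lt_ncard
    (Fintype.one_lt_card.trans hC.card_lt_ncard) P
  obtain ⟨s₁, t₁, hst₁, hne₁⟩ := hparam R₁ hR₁
  obtain ⟨y₁, hy₁⟩ := hline R₁ hR₁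
  have hnonzero : ∀ R, R ≠ P → ∀ y, IsPt ((v.1 + a * y, v.2 + b * y, 1) : K × K × F) R →
      y ≠ 0 := by
    rintro R hR y hy rfl
    rw [mul_zero, mul_zero, add_zero, add_zero] at hy
    exact hR (hy.unique hv)
  have hy₁0 := hnonzero R₁ hR₁P y₁ hy₁
  have hne₁₀ : s₁ * t₀ ≠ s₀ * t₁ := by
    intro h
    exact hR₁P (hiota R₁ hR₁ P hPC (isPt_nrcVec_of_det_eq_zero hd hst₁ hst₀ h))
  -- The point R₁ fixes the constant in the expression of y^(q^i) as a quotient of linear forms: the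
  -- zero is the parameter of P, the pole that of the one conjugate point with possibly nonzero i-th
  -- coordinates.
  have key : ∀ i : Fin n, ∃ j : Fin k, ∀ R ∈ C, ∀ y s t,
      IsPt ((v.1 + a * y, v.2 + b * y, 1) : K × K × F) R →
      IsPt (nrcVec f s t) (iota F K n R) →
      (s₁ * β j - α j * t₁) * y₁ ^ Fintype.card F ^ (i : ℕ) * (s * t₀ - s₀ * t) =
        (s₁ * t₀ - s₀ * t₁) * ((s * β j - α j * t) * y ^ Fintype.card F ^ (i : ℕ)) := by
    intro i
    obtain ⟨l, hl, hl0⟩ := exists_functional (F := F) v hw i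
    have hlast1 : ∀ y : K, lastCoord K n
        (iotaVec F K n (v.1 + a * y, v.2 + b * y, 1)) = 1 := fun y =>
      map_one (algebraMap F K)
    obtain ⟨j, hj⟩ := exists_index hkn hQ0 i
    refine ⟨j, fun R hR y s t hy hst => ?_⟩
    have hrel := form_relation (isForm_nrcVec f l) (isForm_nrcVec f (lastCoord K n)) hpair j
      (fun j' hj' => hl0 _ (hj j' hj' _ (hαβ j')).1 (hj j' hj' _ (hαβ j')).2 (hlast j'))
      hlast (s₀ := s₀) (t₀ := t₀) (s₁ := s₁) (t₁ := t₁) (by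
        have hv' : IsPt ((v.1 + a * 0, v.2 + b * 0, 1) : K × K × F) P := by
          rw [mul_zero, mul_zero, add_zero, add_zero]
          exact hv
        obtain ⟨c, -, e⟩ := (hv'.map _ (iotaVec_injective F K n)).iff_exists_smul.1 hst₀
        rw [e, map_smul, hl, zero_pow (pow_ne_zero _ Fintype.card_ne_zero), smul_zero])
      hne₀ hne₁ hne₁₀ s t
    obtain ⟨c, hc, e⟩ := (hy.map _ (iotaVec_injective F K n)).iff_exists_smul.1 hst
    obtain ⟨c₁, hc₁, e₁⟩ := (hy₁.map _ (iotaVec_injective F K n)).iff_exists_smul.1 hst₁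
    simp only [e, e₁, map_smul, hl, hlast1, smul_eq_mul, mul_one] at hrel
    refine mul_left_cancel₀ (mul_ne_zero hc hc₁) ?_
    linear_combination hrel
  obtain ⟨j₀, key₀⟩ := key ⟨0, by omega⟩
  -- The index 1 exists because 2 ≤ k ≤ n.
  obtain ⟨j₁, key₁⟩ := key ⟨1, by omega⟩
  simp only [pow_zero, pow_one] at key₀ key₁
  have hdet : s₀ * β j₀ - α j₀ * t₀ ≠ 0 := sub_ne_zero.2 (hne₀ j₀)
  have hM : s₁ * t₀ - s₀ * t₁ ≠ 0 := sub_ne_zero.2 hne₁₀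
  have hm₁ : s₁ * β j₁ - α j₁ * t₁ ≠ 0 := sub_ne_zero.2 (hne₁ j₁)
  obtain ⟨A, B, hAB⟩ : ∃ A B : K, ∀ R ∈ C, R ≠ P → ∀ y : K,
      IsPt ((v.1 + a * y, v.2 + b * y, 1) : K × K × F) R →
      y⁻¹ ^ Fintype.card F = A * y⁻¹ + B := by
    refine ⟨(s₀ * β j₁ - α j₁ * t₀) / (s₀ * β j₀ - α j₀ * t₀) * (s₁ * β j₀ - α j₀ * t₁) * y₁ /
        ((s₁ * β j₁ - α j₁ * t₁) * y₁ ^ Fintype.card F),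
      (s₁ * t₀ - s₀ * t₁) * ((α j₁ * β j₀ - α j₀ * β j₁) / (s₀ * β j₀ - α j₀ * t₀)) /
        ((s₁ * β j₁ - α j₁ * t₁) * y₁ ^ Fintype.card F), fun R hR hRP y hy => ?_⟩
    obtain ⟨s, t, hst, -⟩ := hparam R hR
    have hy0 := hnonzero R hRP y hy
    have hL : s * t₀ - s₀ * t ≠ 0 := fun h => hRP (hiota R hR P hPC
      (isPt_nrcVec_of_det_eq_zero hd hst hst₀ (sub_eq_zero.1 h)))
    have k0 := key₀ R hR y s t hy hst
    have k1 := key₁ R hR y s t hy hst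
    exact inv_pow_relation hL hy0 (pow_ne_zero _ hy₁0) hm₁ hdet k0 k1 (by ring)
  refine exists_eq_affineCurve hC.card_lt_ncard hw hv hPC A B fun R hR hRP => ?_
  obtain ⟨y, hy⟩ := hline R hR
  refine ⟨y⁻¹, inv_ne_zero (hnonzero R hRP y hy), hAB R hR hRP y hy, ?_⟩
  rw [inv_inv]
  exact hy

end Reconstruction

/-! ### Normal rational curves with an affine parameter -/

section Curve

variable {k V : Type*} [Field k] [AddCommGroup V] [Module k V]

theorem exists_isPt_nrcVec_iff {d : ℕ} (e : Fin (d + 1) → V) (P : ℙ k V) :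
    (∃ s t : k, IsPt (nrcVec e s t) P) ↔
      IsPt (e (Fin.last d)) P ∨ ∃ t : k, IsPt (nrcVec e 1 t) P := by
  have h0 : nrcVec e (0 : k) 1 = e (Fin.last d) := by
    rw [nrcVec, Finset.sum_eq_single (Fin.last d)]
    · simp
    · intro i _ hi
      have : d - (i : ℕ) ≠ 0 := by
        have := Fin.val_lt_last hi
        omega
      rw [zero_pow this, zero_mul, zero_smul]
    · simp
  constructor
  · rintro ⟨s, t, h⟩
    by_cases hs : s = 0
    · left
      rw [hs, ← mul_zero t, ← mul_one t, mul_assoc, one_mul] at h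
      have := nrcVec_smul e t 0 1
      rw [this, h0] at h
      exact h.of_smul
    · right
      refine ⟨t / s, ?_⟩
      have := nrcVec_smul e s 1 (t / s)
      rw [mul_one, mul_div_cancel₀ _ hs] at this
      rw [this] at h
      exact h.of_smul
  · rintro (h | ⟨t, h⟩)
    · exact ⟨0, 1, by rwa [h0]⟩
    · exact ⟨1, t, h⟩

end Curve

/-! ### Independence is preserved by the embedding -/

section Independence

variable {F K : Type*} [Field F] [Fintype F] [Field K] [Algebra F K] {n : ℕ} [NeZero n]

/-- The embedding `ι` preserves linear independence. -/
theorem linearIndependent_iotaVec (hn : Module.finrank F K = n) {ι : Type*} [Fintype ι]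
    {e : ι → K × K × F} (he : LinearIndependent F e) :
    LinearIndependent K fun i => iotaVec F K n (e i) := by
  classical
  have : Module.Finite F K := Module.finite_of_finrank_pos (by rw [hn]; exact NeZero.pos n)
  have : Finite K := Module.finite_of_finite F
  rw [Fintype.linearIndependent_iff]
  -- Shortest-relation argument: scale one coefficient to 1, apply σ, which fixes the embedded
  -- vectors, and subtract. The shorter relation is trivial, so all coefficients are Frobenius-fixed
  -- and lie in `F`.
  suffices h : ∀ (m : ℕ) (g : ι → K), (Finset.univ.filter fun i => g i ≠ 0).card ≤ m →
      ∑ i, g i • iotaVec F K n (e i) = 0 → ∀ i, g i = 0 from fun g hg => h _ g le_rfl hg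
  intro m
  induction m with
  | zero =>
    intro g hg _ i
    by_contra hi
    rw [Nat.le_zero, Finset.card_eq_zero, Finset.filter_eq_empty_iff] at hg
    exact hg (Finset.mem_univ i) hi
  | succ m ih =>
    intro g hg hsum
    by_contra! hex
    obtain ⟨j, hj⟩ := hex
    obtain ⟨h, hh⟩ : ∃ h : ι → K, h = fun i => (g j)⁻¹ * g i := ⟨_, rfl⟩
    have hhj : h j = 1 := by rw [hh]; exact inv_mul_cancel₀ hj
    have hhsum : ∑ i, h i • iotaVec F K n (e i) = 0 := by
      simp only [hh, mul_smul, ← Finset.smul_sum, hsum, smul_zero]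
    have hfsum : ∑ i, (h i ^ Fintype.card F) • iotaVec F K n (e i) = 0 := by
      have := congrArg (sigmaVec F K n) hhsum
      rw [map_sum, map_zero] at this
      rw [← this]
      refine Finset.sum_congr rfl fun i _ => ?_
      rw [map_smulₛₗ, sigmaVec_iotaVec hn]
      rfl
    have hfix := ih (fun i => h i ^ Fintype.card F - h i) (by
      refine Nat.le_of_lt_succ (lt_of_lt_of_le (Finset.card_lt_card ?_) hg)
      refine Finset.ssubset_iff_of_subset (fun i hi => ?_) |>.2 ⟨j, by simpa using hj, ?_⟩
      · simp only [Finset.mem_filter, Finset.mem_univ, true_and] at hi ⊢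
        intro hgi
        refine hi ?_
        rw [hh]
        simp [hgi]
      · simp [hhj]) (by
      simp only [sub_smul, Finset.sum_sub_distrib, hfsum, hhsum, sub_zero])
    have hF : ∀ i, ∃ c : F, algebraMap F K c = h i := fun i =>
      (mem_range_iff_pow (F := F) (h i)).2 (sub_eq_zero.1 (hfix i))
    choose c hc using hF
    have hcsum : ∑ i, c i • e i = 0 := by
      refine iotaVec_injective F K n ?_
      rw [map_zero, map_sum, ← hhsum]
      refine Finset.sum_congr rfl fun i _ => ?_
      rw [map_smulₛₗ, hc]
    have := Fintype.linearIndependent_iff.1 he c hcsum j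
    rw [← hc, this, map_zero] at hhj
    exact zero_ne_one hhj

end Independence

/-! ### Conjugates of θ and the quotient of its minimal polynomial by X - θ -/

section Frobenius

open Polynomial IntermediateField

variable {F K : Type*} [Field F] [Fintype F] [Field K] [Algebra F K] [Finite K]

theorem card_adjoin_toSubfield (θ : K) :
    Nat.card F⟮θ⟯.toSubfield = Fintype.card F ^ (minpoly F θ).natDegree := by
  have : Fintype F⟮θ⟯ := Fintype.ofFinite _
  rw [← adjoin.finrank (Algebra.IsIntegral.isIntegral (R := F) θ),
    ← Module.card_eq_pow_finrank (K := F) (V := F⟮θ⟯), ← Nat.card_eq_fintype_card]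
  rfl

theorem mem_adjoin_iff_pow (θ x : K) :
    x ∈ F⟮θ⟯ ↔ x ^ (Fintype.card F ^ (minpoly F θ).natDegree) = x := by
  rw [← mem_subfield_iff_pow (card_adjoin_toSubfield (F := F) θ)]
  rfl

/-- The elements fixed by x ↦ x^(q^d) form an algebra over `F` of dimension at most d; containing θ,
it contains F(θ). -/
theorem natDegree_le_of_pow_eq {θ : K} {d : ℕ} (hd : d ≠ 0) (h : θ ^ (Fintype.card F ^ d) = θ) :
    (minpoly F θ).natDegree ≤ d := by
  have hle : Subalgebra.toSubmodule F⟮θ⟯.toSubalgebra ≤ frobFixed F K d := by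
    intro x hx
    rw [adjoin_simple_toSubalgebra_of_isAlgebraic (Algebra.IsAlgebraic.isAlgebraic θ),
      Subalgebra.mem_toSubmodule] at hx
    induction hx using Algebra.adjoin_induction with
    | mem x hx => rw [Set.mem_singleton_iff.1 hx]; exact h
    | algebraMap r => exact algebraMap_pow_q F d r
    | add x y _ _ hx hy => exact Submodule.add_mem _ hx hy
    | mul x y _ _ hx hy =>
      change (x * y) ^ _ = _
      rw [mul_pow, hx, hy]
  rw [← adjoin.finrank (Algebra.IsIntegral.isIntegral (R := F) θ)]
  exact (Submodule.finrank_mono hle).trans (finrank_frobFixed_le hd)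

theorem pow_card_pow_mod (θ : K) (i : ℕ) :
    θ ^ (Fintype.card F ^ (i % (minpoly F θ).natDegree)) = θ ^ (Fintype.card F ^ i) := by
  have h : ∀ m : ℕ, θ ^ (Fintype.card F ^ ((minpoly F θ).natDegree * m)) = θ := by
    intro m
    induction m with
    | zero => simp
    | succ m ih =>
      rw [Nat.mul_succ, pow_add, pow_mul, ih]
      exact (mem_adjoin_iff_pow θ θ).1 (mem_adjoin_simple_self F θ)
  conv_rhs => rw [← Nat.div_add_mod i (minpoly F θ).natDegree, pow_add, pow_mul, h]

theorem pow_card_pow_injOn (θ : K) :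
    Set.InjOn (fun j => θ ^ (Fintype.card F ^ j)) (Set.Iio (minpoly F θ).natDegree) := by
  have key : ∀ i j : ℕ, i < j → j < (minpoly F θ).natDegree →
      θ ^ (Fintype.card F ^ i) ≠ θ ^ (Fintype.card F ^ j) := by
    intro i j hij hj h
    have hd : θ ^ (Fintype.card F ^ (j - i)) = θ := by
      rw [← sub_eq_zero]
      refine pow_eq_zero_iff (pow_ne_zero i (Fintype.card_ne_zero (α := F))) |>.1 ?_
      rw [sub_pow_q, ← pow_mul, ← pow_add, Nat.sub_add_cancel hij.le, h, sub_self]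
    have := natDegree_le_of_pow_eq (F := F) (by omega) hd
    omega
  intro i hi j hj h
  rcases lt_trichotomy i j with hij | hij | hij
  · exact (key i j hij hj h).elim
  · exact hij
  · exact (key j i hij hi h.symm).elim

theorem pow_card_pow_eq_iff (θ : K) (i j : ℕ) :
    θ ^ (Fintype.card F ^ i) = θ ^ (Fintype.card F ^ j) ↔
      i % (minpoly F θ).natDegree = j % (minpoly F θ).natDegree := by
  have hpos := minpoly.natDegree_pos (Algebra.IsIntegral.isIntegral (R := F) θ)
  rw [← pow_card_pow_mod θ i, ← pow_card_pow_mod θ j]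
  exact (pow_card_pow_injOn (F := F) θ).eq_iff (Nat.mod_lt _ hpos) (Nat.mod_lt _ hpos)

variable (F K) in
/-- The `m`-th power of the Frobenius map. -/
def frobPow (m : ℕ) : K →ₐ[F] K := FiniteField.frobeniusAlgHom F K ^ m

theorem frobPow_apply (m : ℕ) (x : K) : frobPow F K m x = x ^ (Fintype.card F ^ m) := by
  induction m with
  | zero => simp [frobPow]
  | succ m ih =>
    rw [frobPow] at ih ⊢
    rw [pow_succ', AlgHom.mul_apply, ih, FiniteField.coe_frobeniusAlgHom, pow_succ, pow_mul]

theorem aeval_frobPow (θ : K) (m : ℕ) : aeval (θ ^ (Fintype.card F ^ m)) (minpoly F θ) = 0 := by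
  rw [← frobPow_apply, aeval_algHom_apply, minpoly.aeval, map_zero]

/-- The first k Frobenius conjugates of θ are distinct roots, and a polynomial of degree k has no
others. -/
theorem exists_eq_pow_of_aeval_eq_zero {θ t : K} (h : aeval t (minpoly F θ) = 0) :
    ∃ j < (minpoly F θ).natDegree, t = θ ^ (Fintype.card F ^ j) := by
  classical
  have hint := Algebra.IsIntegral.isIntegral (R := F) θ
  have hne : (minpoly F θ).map (algebraMap F K) ≠ 0 :=
    (Polynomial.map_ne_zero_iff (algebraMap F K).injective).2 (minpoly.ne_zero hint)
  have hmem : ∀ x : K, x ∈ ((minpoly F θ).map (algebraMap F K)).roots.toFinset ↔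
      aeval x (minpoly F θ) = 0 := by
    intro x
    rw [Multiset.mem_toFinset, mem_roots hne, IsRoot, eval_map_algebraMap]
  have hsub : (Finset.range (minpoly F θ).natDegree).image
      (fun j => θ ^ (Fintype.card F ^ j)) ⊆
        ((minpoly F θ).map (algebraMap F K)).roots.toFinset := by
    intro x hx
    obtain ⟨j, -, rfl⟩ := Finset.mem_image.1 hx
    exact (hmem _).2 (aeval_frobPow θ j)
  have heq := Finset.eq_of_subset_of_card_le hsub (by
    rw [Finset.card_image_of_injOn (by
      rw [Finset.coe_range]
      exact pow_card_pow_injOn θ), Finset.card_range]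
    refine (Multiset.toFinset_card_le _).trans ((card_roots' _).trans ?_)
    rw [natDegree_map])
  have := (hmem t).2 h
  rw [← heq] at this
  obtain ⟨j, hj, e⟩ := Finset.mem_image.1 this
  exact ⟨j, Finset.mem_range.1 hj, e.symm⟩

/-- These k coefficients span F(θ), which has dimension k. -/
theorem linearIndependent_coeff_minpolyDiv (θ : K) :
    LinearIndependent F fun i : Fin (minpoly F θ).natDegree => (minpolyDiv F θ).coeff i := by
  have hint := Algebra.IsIntegral.isIntegral (R := F) θ
  rw [linearIndependent_iff_card_eq_finrank_span, Fintype.card_fin, Set.finrank]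
  have : Submodule.span F (Set.range fun i : Fin (minpoly F θ).natDegree =>
      (minpolyDiv F θ).coeff i) = Subalgebra.toSubmodule F⟮θ⟯.toSubalgebra := by
    rw [adjoin_simple_toSubalgebra_of_isAlgebraic (Algebra.IsAlgebraic.isAlgebraic θ),
      ← span_coeff_minpolyDiv hint]
    apply le_antisymm
    · refine Submodule.span_mono ?_
      rintro _ ⟨i, rfl⟩
      exact ⟨i, rfl⟩
    · rw [Submodule.span_le]
      rintro _ ⟨i, rfl⟩
      by_cases hi : i < (minpoly F θ).natDegree
      · exact Submodule.subset_span ⟨⟨i, hi⟩, rfl⟩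
      · rw [coeff_eq_zero_of_natDegree_lt
          ((natDegree_minpolyDiv_lt hint).trans_le (not_lt.1 hi))]
        exact Submodule.zero_mem _
  rw [this]
  exact (adjoin.finrank hint).symm

theorem aeval_derivative_minpoly_ne_zero (θ : K) : aeval θ (derivative (minpoly F θ)) ≠ 0 := by
  have hint := Algebra.IsIntegral.isIntegral (R := F) θ
  exact (PerfectField.separable_of_irreducible
    (minpoly.irreducible hint)).aeval_derivative_ne_zero (minpoly.aeval F θ)

end Frobenius

/-! ### The curve of a subline satisfies condition (i) -/

section NormalFormCurve

open Polynomial IntermediateField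

variable {F K : Type*} [Field F] [Fintype F] [Field K] [Algebra F K]

/-- The vectors defining `affineCurve F v w θ` as a normal rational curve. -/
def curveVec (F : Type*) {K : Type*} [Field F] [Field K] [Algebra F K] (v w : K × K) (θ : K)
    (i : Fin ((minpoly F θ).natDegree + 1)) : K × K × F :=
  (v.1 * algebraMap F K ((minpoly F θ).coeff i) + w.1 * (minpolyDiv F θ).coeff i,
    v.2 * algebraMap F K ((minpoly F θ).coeff i) + w.2 * (minpolyDiv F θ).coeff i,
    (minpoly F θ).coeff i)

variable [Finite K]

theorem coeff_minpolyDiv_natDegree (θ : K) :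
    (minpolyDiv F θ).coeff (minpoly F θ).natDegree = 0 :=
  coeff_eq_zero_of_natDegree_lt
    (natDegree_minpolyDiv_lt (Algebra.IsIntegral.isIntegral (R := F) θ))

theorem coeff_minpoly_natDegree (θ : K) : (minpoly F θ).coeff (minpoly F θ).natDegree = 1 :=
  minpoly.monic (Algebra.IsIntegral.isIntegral (R := F) θ)

theorem curveVec_last (v w : K × K) (θ : K) : curveVec F v w θ (Fin.last _) = (v.1, v.2, 1) := by
  simp only [curveVec, Fin.val_last, coeff_minpolyDiv_natDegree, coeff_minpoly_natDegree, map_one,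
    mul_one, mul_zero, add_zero]

theorem linearIndependent_curveVec (v : K × K) {w : K × K} (hw : w ≠ 0) (θ : K) :
    LinearIndependent F (curveVec F v w θ) := by
  rw [Fintype.linearIndependent_iff]
  intro c hc
  have h3 : ∑ i, c i * (minpoly F θ).coeff i = 0 := by
    have := congrArg (fun z : K × K × F => z.2.2) hc
    simpa [curveVec, Prod.snd_sum] using this
  have h3' : ∑ i, algebraMap F K (c i) * algebraMap F K ((minpoly F θ).coeff i) = 0 := by
    simp only [← map_mul, ← map_sum, h3, map_zero]
  -- The relation in the last coordinate removes the contribution of v, leaving w times a relation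
  -- among the coefficients of N(X)/(X - θ).
  have hcomp : ∀ x y : K, ∑ i, c i • (x * algebraMap F K ((minpoly F θ).coeff i) +
      y * (minpolyDiv F θ).coeff i) = y * ∑ i : Fin ((minpoly F θ).natDegree + 1),
        c i • (minpolyDiv F θ).coeff i := by
    intro x y
    have : x * ∑ i, algebraMap F K (c i) * algebraMap F K ((minpoly F θ).coeff i) = 0 := by
      rw [h3', mul_zero]
    rw [← zero_add (y * _), ← this, Finset.mul_sum, Finset.mul_sum, ← Finset.sum_add_distrib]
    refine Finset.sum_congr rfl fun i _ => ?_
    simp only [Algebra.smul_def]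
    ring
  have hg : ∑ i : Fin ((minpoly F θ).natDegree + 1), c i • (minpolyDiv F θ).coeff i = 0 := by
    have h1 := congrArg (fun z : K × K × F => z.1) hc
    have h2 := congrArg (fun z : K × K × F => z.2.1) hc
    simp only [curveVec, Prod.fst_sum, Prod.snd_sum, Prod.smul_fst, Prod.smul_snd, hcomp,
      Prod.fst_zero, Prod.snd_zero] at h1 h2
    by_contra hne
    exact hw (Prod.ext ((mul_eq_zero.1 h1).resolve_right hne)
      ((mul_eq_zero.1 h2).resolve_right hne))
  -- The quotient has degree below k, so index k is absent from its relation; the coefficient there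
  -- vanishes afterwards because N is monic.
  rw [Fin.sum_univ_castSucc] at hg h3
  simp only [Fin.val_last, coeff_minpolyDiv_natDegree, smul_zero, add_zero, Fin.val_castSucc,
    coeff_minpoly_natDegree, mul_one] at hg h3
  have hc' := Fintype.linearIndependent_iff.1 (linearIndependent_coeff_minpolyDiv (F := F) θ)
    (fun i => c i.castSucc) hg
  intro i
  induction i using Fin.lastCases with
  | last => simpa [hc'] using h3
  | cast i => exact hc' i

theorem sum_coeff_minpoly {A : Type*} [CommRing A] [Algebra F A] (θ : K) (t : A) :
    ∑ i : Fin ((minpoly F θ).natDegree + 1), t ^ (i : ℕ) *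
      algebraMap F A ((minpoly F θ).coeff i) = aeval t (minpoly F θ) := by
  rw [aeval_eq_sum_range, Finset.sum_range]
  refine Finset.sum_congr rfl fun i _ => ?_
  rw [Algebra.smul_def, mul_comm]

theorem sum_coeff_minpolyDiv (σ : K →+* K) (θ t : K) :
    ∑ i : Fin ((minpoly F θ).natDegree + 1), t ^ (i : ℕ) * σ ((minpolyDiv F θ).coeff i) =
      eval₂ σ t (minpolyDiv F θ) := by
  rw [eval₂_eq_sum_range' σ ((natDegree_minpolyDiv_lt
    (Algebra.IsIntegral.isIntegral (R := F) θ)).trans (Nat.lt_succ_self _)), Finset.sum_range]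
  exact Finset.sum_congr rfl fun i _ => mul_comm _ _

theorem nrcVec_curveVec {v w : K × K} {θ : K} (hθ : θ ∉ (algebraMap F K).fieldRange) (t : F) :
    (minpoly F θ).eval t ≠ 0 ∧ nrcVec (curveVec F v w θ) 1 t = (minpoly F θ).eval t •
      (v.1 + w.1 * (algebraMap F K t - θ)⁻¹, v.2 + w.2 * (algebraMap F K t - θ)⁻¹, (1 : F)) := by
  have hint := Algebra.IsIntegral.isIntegral (R := F) θ
  refine ⟨fun h => hθ ⟨t, minpoly.root hint h⟩, ?_⟩
  have hne : algebraMap F K t - θ ≠ 0 := fun h => hθ ⟨t, sub_eq_zero.1 h⟩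
  have hN := sum_coeff_minpoly (F := F) (A := F) θ t
  have hNK := sum_coeff_minpoly (F := F) (A := K) θ (algebraMap F K t)
  have hg := sum_coeff_minpolyDiv (F := F) (RingHom.id K) θ (algebraMap F K t)
  have hdiv : eval₂ (RingHom.id K) (algebraMap F K t) (minpolyDiv F θ) =
      aeval (algebraMap F K t) (minpoly F θ) * (algebraMap F K t - θ)⁻¹ := by
    rw [← eval_map_algebraMap, ← minpolyDiv_spec F θ, eval_mul, eval_sub, eval_X, eval_C,
      mul_inv_cancel_right₀ hne]
    rfl
  have hae : aeval (algebraMap F K t) (minpoly F θ) = algebraMap F K ((minpoly F θ).eval t) :=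
    aeval_algebraMap_apply_eq_algebraMap_eval t _
  rw [hdiv, hae] at hg
  rw [hae] at hNK
  have hcomp : ∀ x y : K, ∑ i : Fin ((minpoly F θ).natDegree + 1),
      ((1 : F) ^ ((minpoly F θ).natDegree - (i : ℕ)) * t ^ (i : ℕ)) •
        (x * algebraMap F K ((minpoly F θ).coeff i) + y * (minpolyDiv F θ).coeff i) =
      (minpoly F θ).eval t • (x + y * (algebraMap F K t - θ)⁻¹) := by
    intro x y
    rw [Algebra.smul_def, mul_add, mul_left_comm, ← hg, mul_comm _ x, ← hNK, Finset.mul_sum,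
      Finset.mul_sum, ← Finset.sum_add_distrib]
    refine Finset.sum_congr rfl fun i _ => ?_
    rw [one_pow, one_mul, Algebra.smul_def, map_pow, RingHom.id_apply]
    ring
  refine Prod.ext ?_ (Prod.ext ?_ ?_)
  · simp only [nrcVec, curveVec, Prod.fst_sum, Prod.smul_fst, hcomp]
  · simp only [nrcVec, curveVec, Prod.fst_sum, Prod.snd_sum, Prod.smul_fst, Prod.smul_snd, hcomp]
  · simp only [nrcVec, curveVec, Prod.snd_sum, Prod.smul_snd, one_pow, one_mul, smul_eq_mul,
      mul_one]
    rw [← coe_aeval_eq_eval, ← hN]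
    rfl

theorem affineCurve_eq {v w : K × K} {θ : K} (hθ : θ ∉ (algebraMap F K).fieldRange) :
    affineCurve F v w θ = {P | ∃ s t : F, IsPt (nrcVec (curveVec F v w θ) s t) P} := by
  ext P
  simp only [affineCurve, Set.mem_ofPred_eq, exists_isPt_nrcVec_iff, curveVec_last]
  refine or_congr_right (exists_congr fun t => ?_)
  obtain ⟨h0, h⟩ := nrcVec_curveVec (v := v) (w := w) hθ t
  rw [h]
  exact ⟨fun h => h.smul h0, fun h => h.of_smul⟩

theorem two_le_natDegree {θ : K} (hθ : θ ∉ (algebraMap F K).fieldRange) :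
    2 ≤ (minpoly F θ).natDegree := by
  have h0 := minpoly.natDegree_pos (Algebra.IsIntegral.isIntegral (R := F) θ)
  have h1 : (minpoly F θ).natDegree ≠ 1 := fun h =>
    hθ (minpoly.mem_range_of_degree_eq_one F θ ((degree_eq_iff_natDegree_eq_of_pos one_pos).2 h))
  omega

theorem condI_affineCurve (v : K × K) {w : K × K} (hw : w ≠ 0) {θ : K}
    (hθ : θ ∉ (algebraMap F K).fieldRange) (hq : (minpoly F θ).natDegree ≤ Fintype.card F) :
    CondI F K (minpoly F θ).natDegree (affineCurve F v w θ) := by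
  refine ⟨⟨two_le_natDegree hθ, by rwa [Nat.card_eq_fintype_card], curveVec F v w θ,
    linearIndependent_curveVec v hw θ, affineCurve_eq hθ⟩, ?_⟩
  -- The range is the required k-space: c = 1 gives its affine points v + y w, which include the
  -- curve, and c = 0 the spread element of w.
  let L : F × F⟮θ⟯ →ₗ[F] K × K × F :=
    { toFun := fun z => (v.1 * algebraMap F K z.1 + w.1 * z.2,
        v.2 * algebraMap F K z.1 + w.2 * z.2, z.1)
      map_add' := fun x y => by
        refine Prod.ext ?_ (Prod.ext ?_ rfl) <;>
          simp only [Prod.fst_add, Prod.snd_add, map_add, AddMemClass.coe_add] <;> ring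
      map_smul' := fun c x => by
        have hcomp : ∀ a b : K, a * algebraMap F K (c * x.1) + b * ((c • x.2 : F⟮θ⟯) : K) =
            c • (a * algebraMap F K x.1 + b * x.2) := by
          intro a b
          rw [IntermediateField.coe_smul, Algebra.smul_def, Algebra.smul_def, map_mul]
          ring
        exact Prod.ext (hcomp _ _) (Prod.ext (hcomp _ _) rfl) }
  have hLinj : Function.Injective L := by
    rw [← LinearMap.ker_eq_bot, LinearMap.ker_eq_bot']
    rintro ⟨c, y⟩ h
    have hc : c = 0 := congrArg (fun z : K × K × F => z.2.2) h
    subst hc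
    have h1 : v.1 * algebraMap F K 0 + w.1 * y = 0 := congrArg (fun z : K × K × F => z.1) h
    have h2 : v.2 * algebraMap F K 0 + w.2 * y = 0 := congrArg (fun z : K × K × F => z.2.1) h
    rw [map_zero, mul_zero, zero_add] at h1 h2
    have hy : (y : K) = 0 := by
      by_contra hy
      exact hw (Prod.ext ((mul_eq_zero.1 h1).resolve_right hy)
        ((mul_eq_zero.1 h2).resolve_right hy))
    rw [Prod.mk_eq_zero]
    exact ⟨rfl, Subtype.ext hy⟩
  have hmem : ∀ y ∈ F⟮θ⟯, ((v.1 + w.1 * y, v.2 + w.2 * y, 1) : K × K × F) ∈ LinearMap.range L := by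
    intro y hy
    refine ⟨(1, ⟨y, hy⟩), ?_⟩
    change (v.1 * algebraMap F K 1 + w.1 * y, v.2 * algebraMap F K 1 + w.2 * y, (1 : F)) = _
    rw [map_one, mul_one, mul_one]
  refine ⟨LinearMap.range L, ?_, ?_, w.1, w.2, hw, ?_⟩
  · rw [LinearMap.finrank_range_of_inj hLinj, Module.finrank_prod, Module.finrank_self,
      adjoin.finrank (Algebra.IsIntegral.isIntegral (R := F) θ), add_comm]
  · rintro R (hR | ⟨t, hR⟩)
    · rw [hR.mem_pts_iff]
      simpa using hmem 0 (zero_mem _)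
    · rw [hR.mem_pts_iff]
      exact hmem _ (inv_mem (sub_mem (IntermediateField.algebraMap_mem _ t) (mem_adjoin_simple_self F θ)))
  · ext R
    constructor
    · rintro ⟨hR, hR'⟩
      obtain ⟨x, hx⟩ := exists_isPt R
      have hx0 := hx.mem_hInf_iff.1 hR'
      obtain ⟨⟨c, y⟩, rfl⟩ := (hx.mem_pts_iff _).1 hR
      have hc : c = 0 := hx0
      subst hc
      have hL : L (0, y) = (w.1 * y, w.2 * y, 0) := by
        change (v.1 * algebraMap F K 0 + w.1 * y, v.2 * algebraMap F K 0 + w.2 * y, (0 : F)) = _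
        rw [map_zero, mul_zero, mul_zero, zero_add, zero_add]
      rw [hL] at hx
      refine ⟨y, (mem_adjoin_iff_pow θ _).1 y.2, fun hy => hx.ne_zero ?_, hx⟩
      rw [hy, mul_zero, mul_zero]
      rfl
    · rintro ⟨y, hy, -, hR⟩
      refine ⟨(hR.mem_pts_iff _).2 ⟨(0, ⟨y, (mem_adjoin_iff_pow θ _).2 hy⟩), ?_⟩,
        hR.mem_hInf_iff.2 rfl⟩
      change (v.1 * algebraMap F K 0 + w.1 * y, v.2 * algebraMap F K 0 + w.2 * y, (0 : F)) = _
      rw [map_zero, mul_zero, mul_zero, zero_add, zero_add]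

end NormalFormCurve

/-! ### The conjugate points on the indicator set -/

section ConjugatePoints

variable (F : Type*) {K : Type*} [Field F] [Fintype F] [Field K] [Algebra F K]
  (n : ℕ) [NeZero n]

/-- The vector of the `j`-th conjugate point at infinity of the curve `affineCurve F v w θ`. -/
def conjVec (k : ℕ) (w : K × K) (j : ℕ) : VStar K n :=
  (fun i => if (i : ℕ) % k = j % k then w.1 ^ (Fintype.card F ^ (i : ℕ)) else 0,
    fun i => if (i : ℕ) % k = j % k then w.2 ^ (Fintype.card F ^ (i : ℕ)) else 0, 0)

variable {F n}

theorem sigmaVec_conjVec (hn : Module.finrank F K = n) {k : ℕ} (hkn : k ∣ n) (w : K × K) (j : ℕ) :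
    sigmaVec F K n (conjVec F n k w j) = conjVec F n k w (j + 1) := by
  have hmod : ∀ i : Fin n, ((i - 1 : Fin n) : ℕ) % k = j % k ↔ (i : ℕ) % k = (j + 1) % k := by
    intro i
    rw [← sub_one_mod hkn i]
    exact ⟨fun h => Nat.ModEq.add_right 1 h, fun h => Nat.ModEq.add_right_cancel' 1 h⟩
  have key : ∀ (x : K) (i : Fin n),
      (if ((i - 1 : Fin n) : ℕ) % k = j % k then
        x ^ (Fintype.card F ^ ((i - 1 : Fin n) : ℕ)) else 0) ^ Fintype.card F =
      if (i : ℕ) % k = (j + 1) % k then x ^ (Fintype.card F ^ (i : ℕ)) else 0 := by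
    intro x i
    simp only [hmod]
    split_ifs
    · exact pow_val_sub_one hn x i
    · exact zero_pow Fintype.card_ne_zero
  exact Prod.ext (funext fun i => key _ _) (Prod.ext (funext fun i => key _ _)
    (zero_pow Fintype.card_ne_zero))

theorem sigmaVec_iterate_conjVec (hn : Module.finrank F K = n) {k : ℕ} (hkn : k ∣ n) (w : K × K)
    (j : ℕ) : (sigmaVec F K n)^[j] (conjVec F n k w 0) = conjVec F n k w j := by
  induction j with
  | zero => rfl
  | succ j ih => rw [Function.iterate_succ_apply', ih, sigmaVec_conjVec hn hkn]

theorem conjVec_ne_zero {k : ℕ} (hkn : k ∣ n) {w : K × K} (hw : w ≠ 0) (j : ℕ) :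
    conjVec F n k w j ≠ 0 := by
  intro h
  have hn : 0 < n := NeZero.pos n
  have hk : 0 < k := Nat.pos_of_dvd_of_pos hkn hn
  have hj : j % k < n := (Nat.mod_lt _ hk).trans_le (Nat.le_of_dvd hn hkn)
  have h1 := congrArg (fun z : VStar K n => z.1 ⟨j % k, hj⟩) h
  have h2 := congrArg (fun z : VStar K n => z.2.1 ⟨j % k, hj⟩) h
  simp only [conjVec, Nat.mod_mod, if_true] at h1 h2
  exact hw (Prod.ext (pow_eq_zero_iff (pow_ne_zero _ Fintype.card_ne_zero) |>.1 h1)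
    (pow_eq_zero_iff (pow_ne_zero _ Fintype.card_ne_zero) |>.1 h2))

theorem mod_eq_of_smul_conjVec {k : ℕ} (hkn : k ∣ n) {w : K × K} (hw : w ≠ 0) {i j : ℕ} {c : K}
    (h : conjVec F n k w i = c • conjVec F n k w j) : i % k = j % k := by
  by_contra hij
  refine conjVec_ne_zero (F := F) hkn hw i ?_
  refine Prod.ext (funext fun m => ?_) (Prod.ext (funext fun m => ?_) rfl)
  · change (if (m : ℕ) % k = i % k then w.1 ^ (Fintype.card F ^ (m : ℕ)) else 0) = 0
    split_ifs with hm
    · have h1 := congrArg (fun z : VStar K n => z.1 m) h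
      simpa [conjVec, hm, hij] using h1
    · rfl
  · change (if (m : ℕ) % k = i % k then w.2 ^ (Fintype.card F ^ (m : ℕ)) else 0) = 0
    split_ifs with hm
    · have h1 := congrArg (fun z : VStar K n => z.2.1 m) h
      simpa [conjVec, hm, hij] using h1
    · rfl

theorem sigmaVec_iterate_single (w : K × K) (m : ℕ) (hm : m < n) :
    (sigmaVec F K n)^[m] (Pi.single 0 w.1, Pi.single 0 w.2, 0) =
      (Pi.single ⟨m, hm⟩ (w.1 ^ (Fintype.card F ^ m)),
        Pi.single ⟨m, hm⟩ (w.2 ^ (Fintype.card F ^ m)), 0) := by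
  induction m with
  | zero =>
    have : (⟨0, hm⟩ : Fin n) = 0 := rfl
    rw [this, pow_zero, pow_one, pow_one]
    rfl
  | succ m ih =>
    rw [Function.iterate_succ_apply', ih (by omega)]
    have hidx : ∀ i : Fin n, i - 1 = ⟨m, by omega⟩ ↔ i = ⟨m + 1, hm⟩ := by
      intro i
      rw [sub_eq_iff_eq_add]
      have : (⟨m, by omega⟩ + 1 : Fin n) = ⟨m + 1, hm⟩ := by
        refine Fin.ext ?_
        rw [Fin.val_add, Fin.val_one', Nat.add_mod_mod]
        exact Nat.mod_eq_of_lt hm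
      rw [this]
    have key : ∀ (x : K) (i : Fin n),
        (Pi.single (⟨m, by omega⟩ : Fin n) (x ^ (Fintype.card F ^ m)) : Fin n → K) (i - 1) ^
          Fintype.card F =
        (Pi.single (⟨m + 1, hm⟩ : Fin n) (x ^ (Fintype.card F ^ (m + 1))) : Fin n → K) i := by
      intro x i
      simp only [Pi.single_apply, hidx]
      split_ifs
      · rw [← pow_mul, ← pow_succ]
      · exact zero_pow Fintype.card_ne_zero
    exact Prod.ext (funext fun i => key _ _) (Prod.ext (funext fun i => key _ _)
      (zero_pow Fintype.card_ne_zero))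

/-- The nonzero coordinate pairs have index i = k r, and each is the image under σ^(k r) of the
vector of ν with coordinates w. -/
theorem conjVec_mem_span {k : ℕ} (hkn : k ∣ n) (w : K × K) :
    conjVec F n k w 0 ∈ Submodule.span K
      {x | ∃ r < n / k, ∃ v ∈ nu K n, x = (sigmaVec F K n)^[k * r] v} := by
  have hsum : conjVec F n k w 0 = ∑ i : Fin n,
      ((Pi.single i ((conjVec F n k w 0).1 i), Pi.single i ((conjVec F n k w 0).2.1 i), 0) :
        VStar K n) := by
    refine Prod.ext ?_ (Prod.ext ?_ ?_)
    · rw [Prod.fst_sum]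
      exact (Finset.univ_sum_single _).symm
    · rw [Prod.snd_sum, Prod.fst_sum]
      exact (Finset.univ_sum_single _).symm
    · rw [Prod.snd_sum, Prod.snd_sum]
      simp [conjVec]
  rw [hsum]
  refine Submodule.sum_mem _ fun i _ => ?_
  by_cases hi : (i : ℕ) % k = 0
  · have hi' : k * ((i : ℕ) / k) = i := Nat.mul_div_cancel' (Nat.dvd_of_mod_eq_zero hi)
    refine Submodule.subset_span ⟨(i : ℕ) / k, Nat.div_lt_div_of_lt_of_dvd hkn i.2,
      (Pi.single 0 w.1, Pi.single 0 w.2, 0), ?_, ?_⟩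
    · have : ((Pi.single 0 w.1, Pi.single 0 w.2, 0) : VStar K n) =
          w.1 • (Pi.single 0 1, 0, 0) + w.2 • (0, Pi.single 0 1, 0) := by
        simp [← Pi.single_smul]
      rw [this]
      exact Submodule.add_mem _ (Submodule.smul_mem _ _ (Submodule.subset_span (Or.inl rfl)))
        (Submodule.smul_mem _ _ (Submodule.subset_span (Or.inr rfl)))
    · rw [hi', sigmaVec_iterate_single w i i.2]
      simp [conjVec, hi]
  · have h1 : (conjVec F n k w 0).1 i = 0 := by simp [conjVec, hi]
    have h2 : (conjVec F n k w 0).2.1 i = 0 := by simp [conjVec, hi]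
    rw [h1, h2, Pi.single_zero]
    exact Submodule.zero_mem _

end ConjugatePoints

/-! ### The extended curve satisfies condition (ii) -/

section Extension

open Polynomial

variable {F K : Type*} [Field F] [Fintype F] [Field K] [Algebra F K] {n : ℕ} [NeZero n]

theorem iotaVec_nrcVec {d : ℕ} (e : Fin (d + 1) → K × K × F) (s t : F) :
    iotaVec F K n (nrcVec e s t) =
      nrcVec (fun i => iotaVec F K n (e i)) (algebraMap F K s) (algebraMap F K t) := by
  simp only [nrcVec, map_sum, map_smulₛₗ, map_mul, map_pow]

theorem lastCoord_nrcVec [Finite K] (v w : K × K) (θ t : K) :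
    lastCoord K n (nrcVec (fun i => iotaVec F K n (curveVec F v w θ i)) 1 t) =
      aeval t (minpoly F θ) := by
  rw [← sum_coeff_minpoly, nrcVec, map_sum]
  refine Finset.sum_congr rfl fun i _ => ?_
  rw [map_smul, one_pow, one_mul]
  rfl

/-- At the `j`-th conjugate of `θ`, the extended curve passes through the `j`-th conjugate
point. -/
theorem nrcVec_conj [Finite K] (v w : K × K) (θ : K) (j : ℕ) :
    nrcVec (fun i => iotaVec F K n (curveVec F v w θ i)) 1 (θ ^ (Fintype.card F ^ j)) =
      (aeval θ (derivative (minpoly F θ))) ^ (Fintype.card F ^ j) •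
        conjVec F n (minpoly F θ).natDegree w j := by
  classical
  -- The x-part vanishes because N does at conjugates of θ. The m-th conjugate of N(X)/(X - θ)
  -- vanishes at every root of N except θ^(q^m), where its value is that of N'.
  have hcomp : ∀ (x y : K) (m : ℕ), ∑ i : Fin ((minpoly F θ).natDegree + 1),
      ((1 : K) ^ ((minpoly F θ).natDegree - (i : ℕ)) * (θ ^ (Fintype.card F ^ j)) ^ (i : ℕ)) *
        (x * algebraMap F K ((minpoly F θ).coeff i) + y * (minpolyDiv F θ).coeff i) ^
          (Fintype.card F ^ m) =
      (aeval θ (derivative (minpoly F θ))) ^ (Fintype.card F ^ j) *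
        if m % (minpoly F θ).natDegree = j % (minpoly F θ).natDegree then
          y ^ (Fintype.card F ^ m) else 0 := by
    intro x y m
    have h1 := sum_coeff_minpoly (F := F) (A := K) θ (θ ^ (Fintype.card F ^ j))
    rw [aeval_frobPow] at h1
    have h2 := sum_coeff_minpolyDiv (F := F) (frobPow F K m : K →+* K) θ
      (θ ^ (Fintype.card F ^ j))
    have h3 := eval₂_minpolyDiv_self (R := F) θ (frobPow F K m) (frobPow F K j)
    rw [frobPow_apply j θ, frobPow_apply m θ] at h3
    rw [h3] at h2
    have h4 : ∑ i : Fin ((minpoly F θ).natDegree + 1),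
        ((1 : K) ^ ((minpoly F θ).natDegree - (i : ℕ)) * (θ ^ (Fintype.card F ^ j)) ^ (i : ℕ)) *
          (x * algebraMap F K ((minpoly F θ).coeff i) + y * (minpolyDiv F θ).coeff i) ^
            (Fintype.card F ^ m) =
        x ^ (Fintype.card F ^ m) * 0 + y ^ (Fintype.card F ^ m) *
          if θ ^ (Fintype.card F ^ m) = θ ^ (Fintype.card F ^ j) then
            frobPow F K m (aeval θ (derivative (minpoly F θ))) else 0 := by
      rw [← h2, ← h1, Finset.mul_sum, Finset.mul_sum, ← Finset.sum_add_distrib]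
      refine Finset.sum_congr rfl fun i _ => ?_
      rw [one_pow, one_mul, add_pow_q, mul_pow, mul_pow, algebraMap_pow_q, RingHom.coe_coe,
        frobPow_apply]
      ring
    rw [h4, mul_zero, zero_add]
    by_cases hm : θ ^ (Fintype.card F ^ m) = θ ^ (Fintype.card F ^ j)
    · rw [if_pos hm, if_pos ((pow_card_pow_eq_iff θ m j).1 hm), ← aeval_algHom_apply,
        frobPow_apply, hm, ← frobPow_apply j θ, aeval_algHom_apply, frobPow_apply, mul_comm]
    · rw [if_neg hm, if_neg fun h => hm ((pow_card_pow_eq_iff θ m j).2 h), mul_zero, mul_zero]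
  refine Prod.ext (funext fun m => ?_) (Prod.ext (funext fun m => ?_) ?_)
  · refine Eq.trans ?_ (hcomp v.1 w.1 m)
    simp only [nrcVec, Prod.fst_sum, Finset.sum_apply, Prod.smul_fst, Pi.smul_apply, smul_eq_mul]
    rfl
  · refine Eq.trans ?_ (hcomp v.2 w.2 m)
    simp only [nrcVec, Prod.fst_sum, Prod.snd_sum, Finset.sum_apply, Prod.smul_fst, Prod.smul_snd,
      Pi.smul_apply, smul_eq_mul]
    rfl
  · refine (lastCoord_nrcVec (F := F) (n := n) v w θ _).trans ?_
    rw [aeval_frobPow]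
    exact (mul_zero _).symm

theorem condII_affineCurve (hn : Module.finrank F K = n) (v : K × K) {w : K × K} (hw : w ≠ 0)
    {θ : K} (hθ : θ ∉ (algebraMap F K).fieldRange)
    (hq : (minpoly F θ).natDegree ≤ Fintype.card F) (hkn : (minpoly F θ).natDegree ∣ n) :
    CondII F K n (minpoly F θ).natDegree (affineCurve F v w θ) := by
  have : Module.Finite F K := Module.finite_of_finrank_pos (by rw [hn]; exact NeZero.pos n)
  have : Finite K := Module.finite_of_finite F
  obtain ⟨f, hf⟩ : ∃ f : Fin ((minpoly F θ).natDegree + 1) → VStar K n,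
    f = fun i => iotaVec F K n (curveVec F v w θ i) := ⟨_, rfl⟩
  obtain ⟨Q, hQ⟩ : ∃ Q, IsPt (conjVec F n (minpoly F θ).natDegree w 0) Q :=
    ⟨_, isPt_mk (k := K) (conjVec_ne_zero hkn hw 0)⟩
  have hQj : ∀ j, IsPt (conjVec F n (minpoly F θ).natDegree w j) ((sigma F K n)^[j] Q) := by
    intro j
    rw [← sigmaVec_iterate_conjVec hn hkn]
    exact hQ.sigma_iterate j
  have hconj : ∀ j, nrcVec f 1 (θ ^ (Fintype.card F ^ j)) =
      (aeval θ (derivative (minpoly F θ))) ^ (Fintype.card F ^ j) •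
        conjVec F n (minpoly F θ).natDegree w j := fun j => hf ▸ nrcVec_conj v w θ j
  refine ⟨{P | ∃ s t : K, IsPt (nrcVec f s t) P}, ⟨⟨two_le_natDegree hθ, ?_, f, ?_, rfl⟩, ?_⟩,
    Q, ?_, ?_⟩
  · rw [← Nat.card_eq_fintype_card] at hq
    exact hq.trans (Nat.card_le_card_of_injective _ (algebraMap F K).injective)
  · rw [hf]
    exact linearIndependent_iotaVec hn (linearIndependent_curveVec v hw θ)
  · rintro _ ⟨R, hR, rfl⟩
    rw [affineCurve_eq hθ] at hR
    obtain ⟨s, t, hst⟩ := hR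
    refine ⟨algebraMap F K s, algebraMap F K t, ?_⟩
    rw [hf, ← iotaVec_nrcVec]
    exact hst.map _ (iotaVec_injective F K n)
  · intro i hi j hj h
    have hi' := hQj i
    simp only at h
    rw [h] at hi'
    obtain ⟨c, -, e⟩ := (hQj j).iff_exists_smul.1 hi'
    have := mod_eq_of_smul_conjVec hkn hw e
    rwa [Nat.mod_eq_of_lt hi, Nat.mod_eq_of_lt hj] at this
  · ext P
    constructor
    · rintro ⟨hP, hP'⟩
      obtain ⟨r, -, hr⟩ := mem_classSpace_of_mem_indicatorPoints hkn hP'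
      -- Points of the indicator set have last coordinate zero. This excludes the parameter at
      -- infinity, where it is 1, and makes any other parameter a root of N.
      rcases (exists_isPt_nrcVec_iff f P).1 hP with h | ⟨t, h⟩
      · have h0 : (f (Fin.last _)).2.2 = 0 := (hr _ h).1
        rw [hf] at h0
        beta_reduce at h0
        rw [curveVec_last] at h0
        have : algebraMap F K 1 = 0 := h0
        rw [map_one] at this
        exact (one_ne_zero this).elim
      · have h0 : lastCoord K n (nrcVec f 1 t) = 0 := (hr _ h).1
        rw [hf, lastCoord_nrcVec] at h0
        obtain ⟨j, hj, rfl⟩ := exists_eq_pow_of_aeval_eq_zero h0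
        rw [hconj] at h
        exact ⟨j, hj, (hQj j).unique h.of_smul⟩
    · rintro ⟨j, hj, rfl⟩
      refine ⟨⟨1, θ ^ (Fintype.card F ^ j), ?_⟩, ?_⟩
      · rw [hconj]
        exact (hQj j).smul (pow_ne_zero _ (aeval_derivative_minpoly_ne_zero θ))
      · refine Set.mem_biUnion hj ⟨Q, ⟨(hQ.mem_pts_iff _).2 (conjVec_mem_span hkn w), ?_⟩, rfl⟩
        have h := hQj (minpoly F θ).natDegree
        -- The k-th conjugate vector equals the 0-th, so σ^k fixes Q.
        have : conjVec F n (minpoly F θ).natDegree w (minpoly F θ).natDegree =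
            conjVec F n (minpoly F θ).natDegree w 0 := by
          rw [conjVec, conjVec, Nat.mod_self, Nat.zero_mod]
        rw [this] at h
        exact h.unique hQ

end Extension

end ABB

end

/-! ### The theorem -/

theorem theorem2p6 (F K : Type*) [Field F] [Fintype F] [Field K] [Algebra F K]
    (q n : ℕ) [NeZero n] (hq : Fintype.card F = q) (hn : Module.finrank F K = n) (hqn : n ≤ q) :
    (∀ C : Set (ABB.Sig F K),
      (∃ m : Set (ABB.Plane K), ABB.IsSubline K q m ∧ ABB.External m ∧ C = ABB.abbImage F K m) ↔
        ∃ k : ℕ, k ∣ n ∧ ABB.CondI F K k C ∧ ABB.CondII F K n k C) ∧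
    (∀ (m : Set (ABB.Plane K)) (k : ℕ), ABB.IsSubline K q m → ABB.External m → k ∣ n →
      ABB.CondI F K k (ABB.abbImage F K m) → ABB.CondII F K n k (ABB.abbImage F K m) →
      ∃ m' : Set (ABB.Plane K),
        ABB.IsSmallestTangentSubline m m' ∧ ABB.IsSubline K (q ^ k) m') := by
  subst hq
  have : Module.Finite F K := Module.finite_of_finrank_pos (by rw [hn]; exact NeZero.pos n)
  have : Finite K := Module.finite_of_finite F
  have hdvd : ∀ θ : K, (minpoly F θ).natDegree ∣ n := fun θ => hn ▸ minpoly.degree_dvd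
    (Algebra.IsIntegral.isIntegral (R := F) θ)
  have hle : ∀ θ : K, (minpoly F θ).natDegree ≤ Fintype.card F := fun θ =>
    (Nat.le_of_dvd (NeZero.pos n) (hdvd θ)).trans hqn
  refine ⟨fun C => ?_, ?_⟩
  · rw [ABB.exists_external_iff]
    constructor
    · rintro ⟨v, w, θ, hw, hθ, rfl⟩
      exact ⟨_, hdvd θ, ABB.condI_affineCurve v hw hθ (hle θ),
        ABB.condII_affineCurve hn v hw hθ (hle θ) (hdvd θ)⟩
    · rintro ⟨k, hkn, hI, hII⟩
      exact ABB.exists_affineCurve_of_cond hn hkn hI hII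
  · rintro m k ⟨L, hL, u, v, huv, rfl⟩ hext - hI -
    obtain rfl := ABB.fieldRange_eq_of_card hL
    change ABB.External (ABB.subline _ u v) at hext
    change ABB.CondI F K k (ABB.abbImage F K (ABB.subline _ u v)) at hI
    change ∃ m', ABB.IsSmallestTangentSubline (ABB.subline _ u v) m' ∧ _
    obtain ⟨v', w, θ, hw, hθ, h⟩ := ABB.exists_normal_form huv hext
    rw [h, ABB.abbImage_subline hθ] at hI
    -- The dimension of the span of the curve identifies k with the degree of θ.
    obtain rfl := hI.1.degree_unique inferInstance (ABB.condI_affineCurve v' hw hθ (hle θ)).1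
    rw [h]
    refine ⟨ABB.subline (IntermediateField.adjoin F {θ}).toSubfield (ABB.poleVec v' w θ)
      (ABB.affVec v'), ABB.isSmallestTangentSubline v' hw ?_ ?_ ?_,
      _, ABB.card_adjoin_toSubfield θ, _, _, ABB.linearIndependent_pole_aff v' hw θ, rfl⟩
    · rintro _ ⟨c, rfl⟩
      exact (IntermediateField.adjoin F {θ}).algebraMap_mem c
    · exact IntermediateField.mem_adjoin_simple_self F θ
    · intro M hLM hθM x hx
      have : IntermediateField.adjoin F {θ} ≤ M.toIntermediateField fun c => hLM ⟨c, rfl⟩ := by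
        rw [IntermediateField.adjoin_simple_le_iff]
        exact hθM
      exact this hx
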